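/- Let $\Gamma$ be an undirected simple graph with vertex set $V$ and edge set $E$, and let $A_\Gamma=\langle V\mid vw=wv \text{ whenever } \{v,w\}\in E\rangle$ be the associated right angled Artin group. For a group $G$ let $\gamma_1=G$, $\gamma_n=[\gamma_{n-1},G]$ for $n\ge 2$ be the lower central series; let $\gamma_{n,0}=\{g\in G\mid g^k\in\gamma_n\text{ for some integer }k\ne 0\}$ be the rational lower central series; and, for a prime $p$, let $\gamma_{1,p}=G$ and $\gamma_{n,p}=[\gamma_{n-1,p},G]\,\gamma_{\lceil n/p\rceil,p}^{\,p}$ for $n\ge 2$, where $H^p$ denotes the subgroup generated by the $p$-th powers of elements of $H$. Then for $G=A_\Gamma$: 1. $\gamma_n=\gamma_{n,0}$ for all $n\ge1$; 2. $\bigcap_{n\ge1}\gamma_{n,0}=\{1\}$, and $\bigcap_{n\ge1}\gamma_{n,p}=\{1\}$ for every prime $p$; 3. $A_\Gamma$ is finitely generated if $V$ is finite; 4. $A_\Gamma$ is residually torsion-free nilpotent: for every $g\ne1$ in $A_\Gamma$ there is a normal subgroup $N\not\ni g$ such that $A_\Gamma/N$ is nilpotent and torsion-free; 5. for every prime $p$,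 $A_\Gamma$ is residually a finite $p$-group: for every $g\neq1$ in $A_\Gamma$ there is a normal subgroup $N\not\ni g$ such that $A_\Gamma/N$ is a finite $p$-group. -/

import Mathlib

/-- The right angled Artin group `A_Γ`: generators are the vertices of `Γ`, and two generators
commute whenever they span an edge (the relator of an edge is `v * w * v⁻¹ * w⁻¹`). -/
abbrev RAAG {V : Type*} (Γ : SimpleGraph V) : Type _ :=
  PresentedGroup {r : FreeGroup V | ∃ v w : V, Γ.Adj v w ∧
    r = FreeGroup.of v * FreeGroup.of w * (FreeGroup.of v)⁻¹ * (FreeGroup.of w)⁻¹}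

/-- The lower central series indexed from one: `γ_1 = G` and `γ_{n+1} = [γ_n, G]`
(and `γ_0 = G`, as Mathlib's series starts at zero with `G`). -/
def gammaSeries (G : Type*) [Group G] (n : ℕ) : Subgroup G :=
  (⊤ : Subgroup G).lowerCentralSeries (n - 1)

/-- The rational lower central series `γ_{n,0}`: all elements with a nontrivial power in `γ_n`. -/
def rationalGammaSeries (G : Type*) [Group G] (n : ℕ) : Set G :=
  {g : G | ∃ k : ℤ, k ≠ 0 ∧ g ^ k ∈ gammaSeries G n}

/-- The subgroup `H^m` generated by all `m`-th powers of elements of `H`. -/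
def powerSubgroup {G : Type*} [Group G] (H : Subgroup G) (m : ℕ) : Subgroup G :=
  Subgroup.closure {x : G | ∃ h ∈ H, x = h ^ m}

/-- For a prime `p` and `n ≥ 2`, the index `⌈n / p⌉` is smaller than `n`. -/
theorem ceilDiv_prime_lt (p : ℕ) [hp : Fact p.Prime] (n : ℕ) : (n + 2) ⌈/⌉ p < n + 2 := by
  have h2 : 2 ≤ p := hp.out.two_le
  rw [Nat.ceilDiv_eq_add_pred_div, Nat.div_lt_iff_lt_mul (by omega)]
  nlinarith [Nat.mul_le_mul_left n h2, Nat.sub_le (n + 2 + p) 1,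
    Nat.sub_add_cancel (show 1 ≤ n + 2 + p by omega)]

/-- The Brauer-Jennings-Lazard-Zassenhaus series (`p`-dimension series) `γ_{n,p}`, indexed from one:
`γ_{1,p} = G` and `γ_{n,p} = [γ_{n-1,p}, G] (γ_{⌈n/p⌉,p})^p` for `n ≥ 2` (and `γ_{0,p} = G`). -/
def pGammaSeries (p : ℕ) [Fact p.Prime] (G : Type*) [Group G] : ℕ → Subgroup G
  | 0 => ⊤
  | 1 => ⊤
  | n + 2 => ⁅pGammaSeries p G (n + 1), ⊤⁆ ⊔ powerSubgroup (pGammaSeries p G ((n + 2) ⌈/⌉ p)) p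
termination_by n => n
decreasing_by
  · exact Nat.lt_succ_self _
  · exact ceilDiv_prime_lt p n

/-- `G` is residually torsion-free nilpotent: every nontrivial element survives in a torsion-free
nilpotent quotient of `G`. Torsion-free means that only the identity has finite order. -/
def IsResiduallyTorsionFreeNilpotent (G : Type*) [Group G] : Prop :=
  ∀ g : G, g ≠ 1 → ∃ (N : Subgroup G) (_ : N.Normal), g ∉ N ∧
    Group.IsNilpotent (G ⧸ N) ∧ ∀ x : G ⧸ N, IsOfFinOrder x → x = 1

/-- `G` is residually a finite `p`-group: every nontrivial element survives in a quotient of `G`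
that is a finite `p`-group. -/
def IsResiduallyFinitePGroup (p : ℕ) (G : Type*) [Group G] : Prop :=
  ∀ g : G, g ≠ 1 → ∃ (N : Subgroup G) (_ : N.Normal), g ∉ N ∧
    Finite (G ⧸ N) ∧ IsPGroup p (G ⧸ N)

/-!
Let `G` be the right angled Artin group of `Γ`. Elements `a_v` of a ring `A` that commute along the
edges of `Γ` define the Magnus representation `v ↦ 1 + a_v X` of `G` in the units of `A⟦X⟧`
(`RAAG.magnus`). It maps `γ_n` into the units congruent to `1` modulo `X ^ n`, and `γ_{n,p}` too if
`p = 0` in `A`. On `γ_n / γ_{n+1}` the coefficient of `X ^ n` is additive and turns commutators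
into Lie brackets. All parts follow from two choices of `A`.

*Isolation.* It suffices that `γ_n / γ_{n+1}` is torsion-free, and by retracting onto full subgraphs
one may assume that `V` is finite. Let `A` be the ring of the trace monoid over `ℤ`, which is
torsion-free. The claim becomes that the leading coefficient `γ_n / γ_{n+1} → A` is injective
(`RAAG.leadingTerm_injective`). Let `L` be the associated graded Lie ring of `G`, truncated above
degree `n`, and let `p` be a prime. The Lie algebra `L / pL` over the field with `p` elements is
solvable of finite dimension, and so embeds into its enveloping algebra `U`
(`UniversalEnvelopingAlgebra.ι_injective_of_isSolvable`). The classes of the vertices in `U` commute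
along the edges, hence there is a ring homomorphism `A → U` through which the Lie homomorphism
`L → U` factors in degree `n` (`RAAG.coeff_magnus_eq_lieHom`). So an element of the kernel `K` of
the leading coefficient is divisible by `p` in `γ_n / γ_{n+1}`, and then in `K`, as `A` is torsion-free.
As `K` is a finitely generated abelian group and `p` is arbitrary, `K = 0`.

The injectivity of `L → U` for solvable `L` goes by induction on the dimension: `L` is spanned by an
ideal `I` of codimension one and an element `x`, and it acts on the enveloping algebra of `I`, where
`I` acts by left multiplication and `x` by the derivation that extends `ad x`.

*Trivial intersection.* As `γ_n ≤ γ_{n,p}`, it suffices to treat `γ_{n,p}`. A nontrivial element of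
`G` is represented by a nonempty reduced word in syllables `v ^ e`. The power series
`(1 + X) ^ e` over the field with `p` elements has a nonzero coefficient in some positive degree
`c e`. Operators `a_v` on the free module over the states `V → ℕ` are designed so that the word acts
with a nonzero coefficient in the total degree of the `c e`: this coefficient is the product of the
chosen coefficients of the syllables (`RAAG.coeff_magnus_wordProd`).

*Residual properties.* The quotients by `γ_n` are nilpotent, and torsion-free by the first part. If
`V` is finite then the quotients by `γ_{n,p}` are finite `p`-groups; the general case follows by
retracting onto a finite full subgraph.
-/

attribute [local instance] LieRing.ofAssociativeRing

open scoped commutatorElement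

/-! ### Enveloping algebras of solvable Lie algebras -/

namespace UniversalEnvelopingAlgebra

/-- A derivation of a Lie algebra extends to a derivation of its enveloping algebra. -/
theorem exists_derivation_extending {k I : Type*} [CommRing k] [LieRing I]
    [LieAlgebra k I] (D : I →ₗ[k] I) (hD : ∀ y z, D ⁅y, z⁆ = ⁅D y, z⁆ + ⁅y, D z⁆) :
    ∃ δ : UniversalEnvelopingAlgebra k I →ₗ[k] UniversalEnvelopingAlgebra k I,
      (∀ u v, δ (u * v) = u * δ v + δ u * v) ∧ ∀ y, δ (ι k y) = ι k (D y) := by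
  -- The derivation is the second coordinate of the lift of `y ↦ y + ε D y` to dual numbers.
  let f : I →ₗ⁅k⁆ DualNumber (UniversalEnvelopingAlgebra k I) :=
    { toFun := fun y => TrivSqZeroExt.inl (ι k y) + TrivSqZeroExt.inr (ι k (D y))
      map_add' := fun y z => by
        ext <;> simp [-ι_apply]
      map_smul' := fun c y => by
        ext <;> simp [-ι_apply]
      map_lie' := fun {y z} => by
        ext
        · simp [LieRing.of_associative_ring_bracket, -ι_apply, LieHom.map_lie]
        · simp [LieRing.of_associative_ring_bracket, hD, -ι_apply, LieHom.map_lie]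
          abel }
  have hfst : (TrivSqZeroExt.fstHom k _ _).comp (lift k f) = AlgHom.id k _ := by
    ext y
    simp only [LieHom.coe_comp, Function.comp_apply, AlgHom.coe_toLieHom, AlgHom.comp_apply,
      lift_ι_apply]
    simp [f, -ι_apply]
  have hfst' (u : UniversalEnvelopingAlgebra k I) : (lift k f u).fst = u :=
    DFunLike.congr_fun hfst u
  refine ⟨(TrivSqZeroExt.sndHom _ _).restrictScalars k ∘ₗ (lift k f).toLinearMap, ?_, ?_⟩
  · intro u v
    simp [hfst']
  · intro y
    simp only [LinearMap.comp_apply, AlgHom.toLinearMap_apply, lift_ι_apply]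
    simp [f, -ι_apply]

/-- If `f : L → k` is a character of a Lie algebra taking the value `1`, and the ideal `ker f`
embeds into its enveloping algebra, then so does `L`. -/
theorem ι_injective_of_ker {k L : Type*} [CommRing k] [LieRing L] [LieAlgebra k L]
    (f : L →ₗ⁅k⁆ k) (x : L) (hx : f x = 1)
    (h : Function.Injective (ι k : f.ker → UniversalEnvelopingAlgebra k f.ker)) :
    Function.Injective (ι k : L → UniversalEnvelopingAlgebra k L) := by
  have hf (a b : L) : f ⁅a, b⁆ = 0 := by
    rw [LieHom.map_lie, LieRing.of_associative_ring_bracket, mul_comm, sub_self]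
  let D : f.ker →ₗ[k] f.ker :=
    { toFun := fun y => ⟨⁅x, (y : L)⁆, by simp [LieHom.mem_ker, hf]⟩
      map_add' := fun y z => by ext; simp
      map_smul' := fun c y => by ext; simp }
  obtain ⟨δ, hδ, hδι⟩ := exists_derivation_extending D fun y z => by
    ext; simp [D]
  let π : L →ₗ[k] f.ker :=
    { toFun := fun a => ⟨a - f a • x, by simp [LieHom.mem_ker, hx]⟩
      map_add' := fun y z => by ext; simp [add_smul]; abel
      map_smul' := fun c y => by ext; simp [mul_smul, smul_sub] }
  have hπ (a b : L) : π ⁅a, b⁆ = ⁅π a, π b⁆ + f a • D (π b) - f b • D (π a) := by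
    ext
    simp only [π, D, LinearMap.coe_mk, AddHom.coe_mk, hf, zero_smul, sub_zero,
      LieSubmodule.coe_sub, LieSubmodule.coe_add, LieSubmodule.coe_smul,
      LieIdeal.coe_bracket_of_module,
      lie_sub, sub_lie, lie_smul, smul_lie, lie_self, LieSubmodule.coe_bracket, smul_zero]
    rw [← lie_skew x a, smul_neg]
    abel
  -- `L` acts on the enveloping algebra of the kernel: the kernel by left multiplication, and `x`
  -- by the derivation that extends `ad x`.
  let T : L →ₗ⁅k⁆ Module.End k (UniversalEnvelopingAlgebra k f.ker) :=
    { toFun := fun a => LinearMap.mulLeft k (ι k (π a)) + f a • δ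
      map_add' := fun a b => by
        ext u; simp [add_mul, add_smul, -ι_apply]; abel
      map_smul' := fun c a => by
        ext u; simp [mul_smul, -ι_apply]
      map_lie' := fun {a b} => by
        ext u
        simp only [LieRing.of_associative_ring_bracket, hf, hπ, map_add, map_sub, map_smul,
          LieHom.map_lie, LinearMap.add_apply, LinearMap.sub_apply, LinearMap.smul_apply,
          Module.End.mul_apply, LinearMap.mulLeft_apply, hδ, hδι, zero_smul, add_zero, smul_add]
        simp only [sub_mul, add_mul, mul_assoc, smul_mul_assoc, smul_comm (f b) (f a)]
        abel }
  rw [injective_iff_map_eq_zero]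
  intro a ha
  have hfa : f a = 0 := by rw [← lift_ι_apply k f a, ha, map_zero]
  have hTa : T a = 0 := by rw [← lift_ι_apply k T a, ha, map_zero]
  have h1 : T a 1 = ι k (π a) := by simp [T, hfa, -ι_apply]
  rw [hTa, LinearMap.zero_apply, eq_comm] at h1
  have h2 := congrArg Subtype.val ((injective_iff_map_eq_zero _).mp h _ h1)
  simpa [π, hfa] using h2

/-- The injectivity part of the Poincaré–Birkhoff–Witt theorem, for solvable Lie algebras of finite
dimension. -/
theorem ι_injective_of_isSolvable (k : Type*) [Field k] (L : Type*) [LieRing L] [LieAlgebra k L]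
    [FiniteDimensional k L] [LieAlgebra.IsSolvable L] :
    Function.Injective (ι k : L → UniversalEnvelopingAlgebra k L) := by
  induction hn : Module.finrank k L using Nat.strong_induction_on generalizing L with
  | _ n ih =>
    rcases subsingleton_or_nontrivial L with hL | hL
    · exact Function.injective_of_subsingleton _
    have hlt := LieAlgebra.derivedSeries_lt_top_of_solvable k L
    obtain ⟨f, hf0, hf⟩ := Submodule.exists_le_ker_of_lt_top
      (LieAlgebra.derivedSeries k L 1 : LieIdeal k L).toSubmodule (by
        rw [← LieSubmodule.top_toSubmodule (R := k) (L := L)]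
        exact hlt)
    have hf' (a b : L) : f ⁅a, b⁆ = 0 := by
      refine hf ?_
      exact LieSubmodule.lie_mem_lie (LieSubmodule.mem_top a) (LieSubmodule.mem_top b)
    let F : L →ₗ⁅k⁆ k :=
      { f with
        map_lie' := fun {a b} => by
          have : ⁅f a, f b⁆ = 0 := by
            rw [LieRing.of_associative_ring_bracket, mul_comm, sub_self]
          simpa [hf'] using this.symm }
    obtain ⟨y, hy⟩ : ∃ y, f y ≠ 0 := by
      by_contra! h
      exact hf0 (LinearMap.ext h)
    refine ι_injective_of_ker F ((f y)⁻¹ • y) ?_ (ih _ ?_ F.ker rfl)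
    · change f _ = 1
      simp [hy]
    · rw [← hn]
      refine Submodule.finrank_lt (s := F.ker.toSubmodule) fun h => hy ?_
      have : y ∈ F.ker.toSubmodule := h ▸ Submodule.mem_top
      exact (LieHom.mem_ker (f := F) (x := y)).mp this

end UniversalEnvelopingAlgebra

/-! ### Congruence filtration on units of power series rings -/

namespace PowerSeries

/-- The substitution `X ↦ a X`, from power series over a commutative ring `R` to power series over
a possibly noncommutative `R`-algebra `A`. -/
noncomputable def substMulX {R A : Type*} [CommRing R] [Ring A] [Algebra R A] (a : A) :
    PowerSeries R →+* PowerSeries A where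
  toFun f := mk fun n => coeff n f • a ^ n
  map_one' := by
    ext n
    rcases eq_or_ne n 0 with rfl | hn <;> simp [coeff_one, *]
  map_zero' := by ext n; simp
  map_add' f g := by ext n; simp [add_smul]
  map_mul' f g := by
    ext n
    simp only [coeff_mk, coeff_mul, Finset.sum_smul]
    refine Finset.sum_congr rfl fun ij hij => ?_
    rw [smul_mul_smul_comm, ← pow_add, Finset.HasAntidiagonal.mem_antidiagonal.mp hij]

@[simp]
theorem coeff_substMulX {R A : Type*} [CommRing R] [Ring A] [Algebra R A] (a : A)
    (f : PowerSeries R) (n : ℕ) : coeff n (substMulX a f) = coeff n f • a ^ n := by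
  simp [substMulX]

/-- The unit `1 + X` of the ring of power series. -/
noncomputable def unitOneAddX (R : Type*) [CommRing R] : (PowerSeries R)ˣ :=
  (isUnit_iff_constantCoeff.mpr (show IsUnit (constantCoeff (1 + X : PowerSeries R)) by simp)).unit

@[simp]
theorem val_unitOneAddX (R : Type*) [CommRing R] : (unitOneAddX R : PowerSeries R) = 1 + X := rfl

theorem substMulX_one_add_X {R A : Type*} [CommRing R] [Ring A] [Algebra R A] (a : A) :
    substMulX a (1 + X : PowerSeries R) = 1 + monomial 1 a := by
  ext n
  rw [map_add, map_one, map_add, map_add, coeff_substMulX, coeff_X, coeff_monomial]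
  split_ifs with h <;> simp [h]

section Order

variable {A : Type*} [Ring A]

theorem coeff_mul_eq_zero_of_lt {m n : ℕ} {f g : PowerSeries A} (hf : ∀ i < m, coeff i f = 0)
    (hg : ∀ i < n, coeff i g = 0) : ∀ i < m + n, coeff i (f * g) = 0 := by
  intro i hi
  rw [coeff_mul]
  refine Finset.sum_eq_zero fun ab hab => ?_
  have := Finset.HasAntidiagonal.mem_antidiagonal.mp hab
  rcases lt_or_ge ab.1 m with h | h
  · rw [hf _ h, zero_mul]
  · rw [hg _ (by omega), mul_zero]

theorem coeff_add_mul_of_lt {m n : ℕ} {f g : PowerSeries A} (hf : ∀ i < m, coeff i f = 0)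
    (hg : ∀ i < n, coeff i g = 0) : coeff (m + n) (f * g) = coeff m f * coeff n g := by
  rw [coeff_mul]
  refine Finset.sum_eq_single_of_mem (m, n) (by simp) fun ab hab hne => ?_
  have := Finset.HasAntidiagonal.mem_antidiagonal.mp hab
  rcases lt_or_ge ab.1 m with h | h
  · rw [hf _ h, zero_mul]
  · rw [hg _ ?_, mul_zero]
    by_contra h'
    exact hne (Prod.ext (by simp only; omega) (by simp only; omega))

theorem coeff_pow_eq_zero_of_lt {n : ℕ} {f : PowerSeries A} (hf : ∀ i < n, coeff i f = 0) (k : ℕ) :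
    ∀ i < k * n, coeff i (f ^ k) = 0 := by
  induction k with
  | zero => simp
  | succ k ih =>
    rw [pow_succ, Nat.succ_mul]
    exact coeff_mul_eq_zero_of_lt ih hf

variable (A) in
/-- The congruence subgroup of units `u` of `A⟦X⟧` with `u ≡ 1` modulo `X ^ n`. -/
def congruenceUnits (n : ℕ) : Subgroup (PowerSeries A)ˣ where
  carrier := {u | ∀ i < n, coeff i (u - 1 : PowerSeries A) = 0}
  one_mem' := by simp
  mul_mem' {u v} hu hv i hi := by
    have h : (u * v : PowerSeries A) - 1 = (u - 1) * v + (v - 1) := by noncomm_ring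
    have h1 := coeff_mul_eq_zero_of_lt (n := 0) (g := (v : PowerSeries A)) hu (by simp) i hi
    rw [Units.val_mul, h, map_add, h1, hv i hi, add_zero]
  inv_mem' {u} hu i hi := by
    have h : ((u⁻¹ : (PowerSeries A)ˣ) : PowerSeries A) - 1 =
        (u - 1) * (-(u⁻¹ : (PowerSeries A)ˣ)) := by
      rw [sub_mul, mul_neg, Units.mul_inv]; noncomm_ring
    rw [h]
    exact coeff_mul_eq_zero_of_lt (n := 0) hu (by simp) i hi

theorem mem_congruenceUnits {n : ℕ} {u : (PowerSeries A)ˣ} :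
    u ∈ congruenceUnits A n ↔ ∀ i < n, coeff i (u - 1 : PowerSeries A) = 0 := Iff.rfl

theorem congruenceUnits_antitone : Antitone (congruenceUnits A) :=
  fun _ _ h _ hu i hi => hu i (hi.trans_le h)

theorem congruenceUnits_zero : congruenceUnits A 0 = ⊤ := by
  ext u; simp [mem_congruenceUnits]

theorem coeff_zero_of_mem_congruenceUnits {n : ℕ} (hn : 0 < n) {u : (PowerSeries A)ˣ}
    (hu : u ∈ congruenceUnits A n) : coeff 0 (u : PowerSeries A) = 1 := by
  have := hu 0 hn
  rwa [map_sub, coeff_zero_one, sub_eq_zero] at this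

theorem coeff_sub_one {n : ℕ} (hn : 0 < n) (f : PowerSeries A) :
    coeff n (f - 1) = coeff n f := by
  rw [map_sub, coeff_one, if_neg hn.ne', sub_zero]

theorem commutatorElement_sub_one (u v : (PowerSeries A)ˣ) :
    ((⁅u, v⁆ : (PowerSeries A)ˣ) : PowerSeries A) - 1 =
      ((u - 1) * (v - 1) - (v - 1) * (u - 1)) * (u⁻¹ * v⁻¹ : (PowerSeries A)ˣ) := by
  have h : ((v * u : (PowerSeries A)ˣ) : PowerSeries A) * (u⁻¹ * v⁻¹ : (PowerSeries A)ˣ) = 1 := by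
    rw [← Units.val_mul]; simp
  rw [show ((u : PowerSeries A) - 1) * (v - 1) - (v - 1) * (u - 1)
    = (u * v : (PowerSeries A)ˣ) - (v * u : (PowerSeries A)ˣ) by push_cast; noncomm_ring,
    sub_mul, h, ← Units.val_mul, commutatorElement_def, mul_assoc (u * v)]

theorem commutatorElement_mem_congruenceUnits {m n : ℕ} {u v : (PowerSeries A)ˣ}
    (hu : u ∈ congruenceUnits A m) (hv : v ∈ congruenceUnits A n) :
    ⁅u, v⁆ ∈ congruenceUnits A (m + n) := by
  rw [mem_congruenceUnits, commutatorElement_sub_one]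
  refine coeff_mul_eq_zero_of_lt (n := 0) (fun i hi => ?_) (by simp)
  rw [map_sub, coeff_mul_eq_zero_of_lt hu hv i hi,
    coeff_mul_eq_zero_of_lt hv hu i (by rwa [add_comm]), sub_zero]

/-- The leading coefficient of a commutator is the Lie bracket of the leading coefficients. -/
theorem coeff_commutatorElement {m n : ℕ} (hm : 0 < m) (hn : 0 < n) {u v : (PowerSeries A)ˣ}
    (hu : u ∈ congruenceUnits A m) (hv : v ∈ congruenceUnits A n) :
    coeff (m + n) ((⁅u, v⁆ : (PowerSeries A)ˣ) : PowerSeries A) =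
      ⁅coeff m (u : PowerSeries A), coeff n (v : PowerSeries A)⁆ := by
  have h1 : coeff 0 ((u⁻¹ * v⁻¹ : (PowerSeries A)ˣ) : PowerSeries A) = 1 :=
    coeff_zero_of_mem_congruenceUnits one_pos
      (mul_mem (inv_mem (congruenceUnits_antitone hm hu)) (inv_mem (congruenceUnits_antitone hn hv)))
  rw [← coeff_sub_one (by omega), commutatorElement_sub_one]
  have h2 := coeff_add_mul_of_lt (m := m + n) (n := 0)
    (f := ((u : PowerSeries A) - 1) * ((v : PowerSeries A) - 1) -
      ((v : PowerSeries A) - 1) * ((u : PowerSeries A) - 1))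
    (g := ((u⁻¹ * v⁻¹ : (PowerSeries A)ˣ) : PowerSeries A)) (fun i hi => by
      rw [map_sub, coeff_mul_eq_zero_of_lt hu hv i hi,
        coeff_mul_eq_zero_of_lt hv hu i (by rwa [add_comm]), sub_zero]) (by simp)
  rw [add_zero] at h2
  rw [h2, h1, mul_one, map_sub, coeff_add_mul_of_lt hu hv, add_comm m n,
    coeff_add_mul_of_lt hv hu, coeff_sub_one hm, coeff_sub_one hn,
    LieRing.of_associative_ring_bracket]

theorem coeff_mul_of_mem_congruenceUnits {n : ℕ} (hn : 0 < n) {u v : (PowerSeries A)ˣ}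
    (hu : u ∈ congruenceUnits A n) (hv : v ∈ congruenceUnits A n) :
    coeff n ((u * v : (PowerSeries A)ˣ) : PowerSeries A) =
      coeff n (u : PowerSeries A) + coeff n (v : PowerSeries A) := by
  have h : (u * v : PowerSeries A) - 1 = (u - 1) * (v - 1) + (u - 1) + (v - 1) := by noncomm_ring
  have h1 := coeff_mul_eq_zero_of_lt hu hv n (by omega)
  rw [← coeff_sub_one hn, Units.val_mul, h, map_add, map_add, h1, coeff_sub_one hn,
    coeff_sub_one hn, zero_add]

/-- Over a ring in which `p = 0`, the `p`-th power map multiplies the depth of congruence by `p`. -/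
theorem pow_mem_congruenceUnits {p : ℕ} (hp : p.Prime) (hA : (p : A) = 0) {n : ℕ}
    {u : (PowerSeries A)ˣ} (hu : u ∈ congruenceUnits A n) :
    u ^ p ∈ congruenceUnits A (p * n) := by
  have hA' : (p : PowerSeries A) = 0 := by
    rw [← map_natCast (C (R := A)), hA, map_zero]
  obtain ⟨r, hr⟩ := (Commute.one_right (u - 1 : PowerSeries A)).exists_add_pow_prime_eq hp
  rw [mem_congruenceUnits, Units.val_pow_eq_pow_val]
  rw [sub_add_cancel, one_pow, hA', zero_mul, zero_mul, zero_mul, add_zero] at hr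
  rw [hr, add_sub_cancel_right]
  exact coeff_pow_eq_zero_of_lt hu p

variable (A) in
/-- On units congruent to `1` modulo `X ^ n`, the coefficient of `X ^ n` is additive. -/
noncomputable def leadingCoeffHom {n : ℕ} (hn : 0 < n) :
    congruenceUnits A n →* Multiplicative A where
  toFun u := .ofAdd (coeff n ((u : (PowerSeries A)ˣ) : PowerSeries A))
  map_one' := by simp [coeff_one, hn.ne']
  map_mul' u v := by
    rw [← ofAdd_add, ← coeff_mul_of_mem_congruenceUnits hn u.2 v.2]
    rfl

theorem coeff_eq_zero_of_mem_congruenceUnits_succ {n : ℕ} (hn : 0 < n) {u : (PowerSeries A)ˣ}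
    (hu : u ∈ congruenceUnits A (n + 1)) : coeff n (u : PowerSeries A) = 0 := by
  rw [← coeff_sub_one hn]
  exact hu n n.lt_succ_self

end Order

end PowerSeries

/-! ### Magnus representations of right angled Artin groups -/

namespace RAAG

open PowerSeries

variable {V : Type*} {Γ : SimpleGraph V}

theorem closure_range_of (Γ : SimpleGraph V) :
    Subgroup.closure (Set.range (PresentedGroup.of : V → RAAG Γ)) = ⊤ :=
  PresentedGroup.closure_range_of _

theorem fg [Finite V] : Group.FG (RAAG Γ) :=
  Group.fg_iff.mpr ⟨_, closure_range_of Γ, Set.finite_range _⟩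

/-- The universal property of right angled Artin groups. -/
def lift {H : Type*} [Group H] (f : V → H) (hf : ∀ v w, Γ.Adj v w → Commute (f v) (f w)) :
    RAAG Γ →* H :=
  PresentedGroup.toGroup (f := f) <| by
    rintro r ⟨v, w, hvw, rfl⟩
    simp [(hf v w hvw).eq]

@[simp]
theorem lift_of {H : Type*} [Group H] (f : V → H) (hf : ∀ v w, Γ.Adj v w → Commute (f v) (f w))
    (v : V) : lift f hf (PresentedGroup.of v) = f v :=
  PresentedGroup.toGroup.of _

theorem commute_of_adj {v w : V} (h : Γ.Adj v w) :
    Commute (PresentedGroup.of v : RAAG Γ) (PresentedGroup.of w) := by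
  have : (PresentedGroup.mk _ (FreeGroup.of v * FreeGroup.of w * (FreeGroup.of v)⁻¹ *
      (FreeGroup.of w)⁻¹) : RAAG Γ) = 1 := PresentedGroup.one_of_mem ⟨v, w, h, rfl⟩
  rw [map_mul, map_mul, map_mul, map_inv, map_inv, mul_inv_eq_one, mul_inv_eq_iff_eq_mul] at this
  exact this

/-- The Magnus representation `v ↦ 1 + a_v X` of a right angled Artin group, for elements `a_v` of
an `R`-algebra that commute along the edges. -/
noncomputable def magnus (R : Type*) {A : Type*} [CommRing R] [Ring A] [Algebra R A] (a : V → A)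
    (ha : ∀ v w, Γ.Adj v w → Commute (a v) (a w)) : RAAG Γ →* (PowerSeries A)ˣ :=
  lift (fun v => Units.map (substMulX (R := R) (a v)).toMonoidHom (unitOneAddX R)) fun v w h => by
    have h1 : Commute (monomial 1 (a v)) (monomial 1 (a w)) := by
      rw [commute_iff_eq, monomial_mul_monomial, monomial_mul_monomial, (ha v w h).eq]
    ext1
    simp only [Units.val_mul, Units.coe_map, RingHom.toMonoidHom_eq_coe, MonoidHom.coe_coe,
      val_unitOneAddX, substMulX_one_add_X]
    exact ((Commute.one_left _).add_left ((Commute.one_right _).add_right h1)).eq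

section Magnus

variable {R A : Type*} [CommRing R] [Ring A] [Algebra R A] {a : V → A}
  (ha : ∀ v w, Γ.Adj v w → Commute (a v) (a w))

theorem magnus_of (v : V) : magnus R a ha (PresentedGroup.of v) =
    Units.map (substMulX (R := R) (a v)).toMonoidHom (unitOneAddX R) :=
  lift_of ..

theorem val_magnus_of (v : V) :
    (magnus R a ha (PresentedGroup.of v) : PowerSeries A) = 1 + monomial 1 (a v) := by
  rw [magnus_of, ← substMulX_one_add_X (R := R)]
  rfl

theorem coeff_magnus_of_zpow (v : V) (e : ℤ) (n : ℕ) :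
    coeff n (magnus R a ha (PresentedGroup.of v ^ e) : PowerSeries A) =
      coeff n ((unitOneAddX R ^ e : (PowerSeries R)ˣ) : PowerSeries R) • a v ^ n := by
  rw [map_zpow, magnus_of, ← map_zpow]
  exact coeff_substMulX ..

/-- The coefficient of degree `n` in the Magnus representation. -/
noncomputable def magnusCoeff (n : ℕ) (g : RAAG Γ) : A :=
  coeff n (magnus R a ha g : PowerSeries A)

theorem magnusCoeff_one (n : ℕ) : magnusCoeff (R := R) ha n 1 = if n = 0 then 1 else 0 := by
  rw [magnusCoeff, map_one, Units.val_one, coeff_one]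

theorem magnusCoeff_mul (n : ℕ) (g h : RAAG Γ) : magnusCoeff (R := R) ha n (g * h) =
    ∑ ij ∈ Finset.HasAntidiagonal.antidiagonal n,
      magnusCoeff (R := R) ha ij.1 g * magnusCoeff (R := R) ha ij.2 h := by
  rw [magnusCoeff, map_mul, Units.val_mul, coeff_mul]
  rfl

theorem magnusCoeff_of_zpow (v : V) (e : ℤ) (n : ℕ) :
    magnusCoeff (R := R) ha n (PresentedGroup.of v ^ e) =
      coeff n ((unitOneAddX R ^ e : (PowerSeries R)ˣ) : PowerSeries R) • a v ^ n :=
  coeff_magnus_of_zpow ..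

theorem magnus_mem_congruenceUnits_one (g : RAAG Γ) :
    magnus R a ha g ∈ congruenceUnits A 1 := by
  have : (⊤ : Subgroup (RAAG Γ)) ≤ (congruenceUnits A 1).comap (magnus R a ha) := by
    rw [← closure_range_of, Subgroup.closure_le]
    rintro _ ⟨v, rfl⟩
    rw [SetLike.mem_coe, Subgroup.mem_comap, mem_congruenceUnits, val_magnus_of]
    intro i hi
    obtain rfl : i = 0 := by omega
    simp [coeff_monomial]
  exact this (Subgroup.mem_top g)

/-- The Magnus representation maps the lower central series to the congruence filtration. -/
theorem magnus_mem_congruenceUnits {n : ℕ} {g : RAAG Γ} (hg : g ∈ gammaSeries (RAAG Γ) n) :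
    magnus R a ha g ∈ congruenceUnits A n := by
  suffices ∀ n, gammaSeries (RAAG Γ) (n + 1) ≤
      (congruenceUnits A (n + 1)).comap (magnus R a ha) by
    rcases n with _ | n
    · rw [congruenceUnits_zero]; trivial
    · exact this n hg
  intro n
  induction n with
  | zero => exact fun g _ => magnus_mem_congruenceUnits_one ha g
  | succ n ih =>
    refine Subgroup.commutator_le.mpr fun x hx y _ => ?_
    rw [Subgroup.mem_comap, map_commutatorElement]
    exact commutatorElement_mem_congruenceUnits (ih hx) (magnus_mem_congruenceUnits_one ha y)

/-- In characteristic `p`, the Magnus representation maps the `p`-dimension series to the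
congruence filtration. -/
theorem magnus_mem_congruenceUnits_of_mem_pGammaSeries (p : ℕ) [Fact p.Prime] (hA : (p : A) = 0)
    (n : ℕ) : pGammaSeries p (RAAG Γ) n ≤ (congruenceUnits A n).comap (magnus R a ha) := by
  induction n using Nat.strong_induction_on with
  | _ n ih =>
    match n with
    | 0 => rw [congruenceUnits_zero]; exact fun _ _ => trivial
    | 1 => exact fun g _ => magnus_mem_congruenceUnits_one ha g
    | n + 2 =>
      rw [pGammaSeries, sup_le_iff, Subgroup.commutator_le, powerSubgroup, Subgroup.closure_le]
      constructor
      · intro x hx y _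
        rw [Subgroup.mem_comap, map_commutatorElement]
        exact commutatorElement_mem_congruenceUnits (m := n + 1) (n := 1) (ih (n + 1) (by omega) hx)
          (magnus_mem_congruenceUnits_one ha y)
      · rintro _ ⟨x, hx, rfl⟩
        rw [SetLike.mem_coe, Subgroup.mem_comap, map_pow]
        refine congruenceUnits_antitone ?_ (pow_mem_congruenceUnits Fact.out hA
          (ih _ (ceilDiv_prime_lt p n) hx))
        have h := le_smul_ceilDiv (α := ℕ) (β := ℕ) (a := p) (b := n + 2) (Nat.Prime.pos Fact.out)
        exact h

/-- Magnus representations are natural in the ring of coefficients. -/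
theorem map_coeff_magnus {B : Type*} [Ring B] [Algebra R B] (h : A →+* B)
    {b : V → B} (hb : ∀ v w, Γ.Adj v w → Commute (b v) (b w)) (hab : ∀ v, h (a v) = b v)
    (g : RAAG Γ) (n : ℕ) :
    coeff n (magnus R b hb g : PowerSeries B) = h (coeff n (magnus R a ha g : PowerSeries A)) := by
  have : magnus R b hb = (Units.map (PowerSeries.map h).toMonoidHom).comp (magnus R a ha) := by
    refine PresentedGroup.ext fun v => Units.ext ?_
    rw [val_magnus_of]
    simp only [MonoidHom.comp_apply, Units.coe_map, RingHom.toMonoidHom_eq_coe, MonoidHom.coe_coe,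
      val_magnus_of, map_add, map_one, ← hab]
    congr 1
    ext n
    simp only [coeff_map, coeff_monomial]
    split_ifs <;> simp
  rw [this, ← coeff_map]
  rfl

end Magnus

end RAAG

/-! ### The lower central series -/

section GammaSeries

variable {G : Type*} [Group G]

theorem mem_gammaSeries_one (g : G) : g ∈ gammaSeries G 1 := Subgroup.mem_top g

theorem gammaSeries_add_two (n : ℕ) : gammaSeries G (n + 2) = ⁅gammaSeries G (n + 1), ⊤⁆ := rfl

theorem gammaSeries_antitone : Antitone (gammaSeries G) :=
  fun _ _ h => Subgroup.lowerCentralSeries_antitone _ (Nat.sub_le_sub_right h 1)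

instance gammaSeries_normal (n : ℕ) : (gammaSeries G n).Normal := by
  unfold gammaSeries; infer_instance

/-- The three subgroups lemma modulo a normal subgroup. -/
theorem Subgroup.commutator_commutator_le_of_rotate {H₁ H₂ H₃ N : Subgroup G} [N.Normal]
    (h1 : ⁅⁅H₂, H₃⁆, H₁⁆ ≤ N) (h2 : ⁅⁅H₃, H₁⁆, H₂⁆ ≤ N) : ⁅⁅H₁, H₂⁆, H₃⁆ ≤ N := by
  have key (K : Subgroup G) : K ≤ N ↔ K.map (QuotientGroup.mk' N) = ⊥ := by
    rw [Subgroup.map_eq_bot_iff, QuotientGroup.ker_mk']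
  rw [key, Subgroup.map_commutator, Subgroup.map_commutator] at h1 h2 ⊢
  exact Subgroup.commutator_commutator_eq_bot_of_rotate h1 h2

theorem commutator_gammaSeries_le (m n : ℕ) :
    ⁅gammaSeries G m, gammaSeries G n⁆ ≤ gammaSeries G (m + n) := by
  suffices ∀ n m, ⁅gammaSeries G m, gammaSeries G (n + 1)⁆ ≤ gammaSeries G (m + (n + 1)) by
    rcases n with _ | n
    · exact Subgroup.commutator_le_left _ _
    · exact this n m
  intro n
  induction n with
  | zero =>
    intro m
    rcases m with _ | m
    · exact le_top
    · exact le_rfl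
  | succ n ih =>
    intro m
    rw [gammaSeries_add_two, Subgroup.commutator_comm]
    refine Subgroup.commutator_commutator_le_of_rotate ?_ ?_
    · have h := ih (m + 1)
      rw [show m + 1 + (n + 1) = m + (n + 1 + 1) by ring] at h
      refine le_trans (Subgroup.commutator_mono ?_ le_rfl) h
      rw [Subgroup.commutator_comm]
      rcases m with _ | m
      · exact le_top
      · exact le_rfl
    · exact Subgroup.commutator_mono (ih m) le_rfl

theorem commutatorElement_mem_gammaSeries {m n : ℕ} {x y : G} (hx : x ∈ gammaSeries G m)
    (hy : y ∈ gammaSeries G n) : ⁅x, y⁆ ∈ gammaSeries G (m + n) :=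
  commutator_gammaSeries_le m n (Subgroup.commutator_mem_commutator hx hy)

theorem gammaSeries_induction {n : ℕ} {P : ∀ g ∈ gammaSeries G (n + 2), Prop}
    (comm : ∀ x (hx : x ∈ gammaSeries G (n + 1)) y,
      P ⁅x, y⁆ (Subgroup.commutator_mem_commutator hx (Subgroup.mem_top y)))
    (one : P 1 (one_mem _)) (mul : ∀ x y hx hy, P x hx → P y hy → P (x * y) (mul_mem hx hy))
    (inv : ∀ x hx, P x hx → P x⁻¹ (inv_mem hx)) : ∀ g hg, P g hg :=
  fun _ hg => Subgroup.closure_induction (p := P) (by rintro _ ⟨x, hx, y, -, rfl⟩; exact comm x hx y)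
    one mul inv hg

end GammaSeries

/-! ### The truncated associated graded Lie ring -/

section Graded

variable (G : Type*) [Group G] (N : ℕ)

/-- The denominator of the degree `n` component of the associated graded Lie ring truncated above
degree `N`: it is `γ_{n+1}` for `n ≤ N`, and `γ_n` for `n > N`, so that components of degree
greater than `N` vanish. -/
def grDenom (n : ℕ) : Subgroup G := gammaSeries G (if n ≤ N then n + 1 else n)

instance grDenom_normal (n : ℕ) : (grDenom G N n).Normal := gammaSeries_normal _

/-- The degree `n` component `γ_n / γ_{n+1}` of the associated graded Lie ring, replaced by zero
when `n > N`. The component of degree zero vanishes too, as `γ_0 = γ_1`. -/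
def GrComp (n : ℕ) : Type _ :=
  Additive (gammaSeries G n ⧸ (grDenom G N n).subgroupOf (gammaSeries G n))

variable {G N}

theorem gammaSeries_succ_le_grDenom (n : ℕ) : gammaSeries G (n + 1) ≤ grDenom G N n :=
  gammaSeries_antitone (by split_ifs <;> omega)

theorem commutatorElement_mem_grDenom {m n : ℕ} {x y : G} (hx : x ∈ grDenom G N m)
    (hy : y ∈ gammaSeries G n) : ⁅x, y⁆ ∈ grDenom G N (m + n) := by
  refine gammaSeries_antitone ?_ (commutatorElement_mem_gammaSeries hx hy)
  split_ifs <;> omega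

theorem commutatorElement_mem_grDenom' {m n : ℕ} {x y : G} (hx : x ∈ gammaSeries G m)
    (hy : y ∈ grDenom G N n) : ⁅x, y⁆ ∈ grDenom G N (m + n) := by
  rw [← commutatorElement_inv, add_comm]
  exact inv_mem (commutatorElement_mem_grDenom hy hx)

theorem commutatorElement_mem_gammaSeries_succ {n : ℕ} {x : G} (hx : x ∈ gammaSeries G n) (y : G) :
    ⁅x, y⁆ ∈ gammaSeries G (n + 1) :=
  commutatorElement_mem_gammaSeries (n := 1) hx (mem_gammaSeries_one y)

instance (n : ℕ) : CommGroup (gammaSeries G n ⧸ (grDenom G N n).subgroupOf (gammaSeries G n)) where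
  mul_comm a b := by
    induction a using QuotientGroup.induction_on with | _ a
    induction b using QuotientGroup.induction_on with | _ b
    refine QuotientGroup.eq.mpr ?_
    rw [Subgroup.mem_subgroupOf]
    have h := gammaSeries_succ_le_grDenom (N := N) n
      (commutatorElement_mem_gammaSeries_succ (inv_mem b.2) (a : G)⁻¹)
    simpa [commutatorElement_def, mul_assoc] using h

instance (n : ℕ) : AddCommGroup (GrComp G N n) :=
  inferInstanceAs (AddCommGroup (Additive
    (gammaSeries G n ⧸ (grDenom G N n).subgroupOf (gammaSeries G n))))

/-- The class of an element of `γ_n` in the degree `n` component of the graded Lie ring. -/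
def grMk (N n : ℕ) (g : G) (hg : g ∈ gammaSeries G n) : GrComp G N n :=
  Additive.ofMul (QuotientGroup.mk ⟨g, hg⟩)

theorem grMk_surjective {n : ℕ} (x : GrComp G N n) : ∃ g hg, grMk N n g hg = x := by
  induction x using QuotientGroup.induction_on with | _ a
  exact ⟨a, a.2, rfl⟩

theorem grMk_eq_iff {n : ℕ} {g h : G} {hg : g ∈ gammaSeries G n} {hh : h ∈ gammaSeries G n} :
    grMk N n g hg = grMk N n h hh ↔ g⁻¹ * h ∈ grDenom G N n :=
  QuotientGroup.eq.trans Subgroup.mem_subgroupOf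

theorem grMk_mul {n : ℕ} {g h : G} (hg : g ∈ gammaSeries G n) (hh : h ∈ gammaSeries G n) :
    grMk N n (g * h) (mul_mem hg hh) = grMk N n g hg + grMk N n h hh := rfl

theorem grMk_one {n : ℕ} : grMk N n (1 : G) (one_mem _) = 0 := rfl

theorem grMk_inv {n : ℕ} {g : G} (hg : g ∈ gammaSeries G n) :
    grMk N n g⁻¹ (inv_mem hg) = -grMk N n g hg := rfl

theorem grMk_eq_zero_iff {n : ℕ} {g : G} {hg : g ∈ gammaSeries G n} :
    grMk N n g hg = 0 ↔ g ∈ grDenom G N n := by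
  rw [eq_comm, ← grMk_one, grMk_eq_iff, inv_one, one_mul]

theorem grMk_conj {n : ℕ} {g : G} (hg : g ∈ gammaSeries G n) (h : G) :
    grMk N n (h * g * h⁻¹) ((gammaSeries_normal n).conj_mem g hg h) = grMk N n g hg := by
  rw [grMk_eq_iff]
  refine gammaSeries_succ_le_grDenom n ?_
  convert commutatorElement_mem_gammaSeries_succ ((gammaSeries_normal n).conj_mem _ (inv_mem hg) h) h⁻¹
    using 1
  simp [commutatorElement_def, mul_assoc]

theorem grMk_commutator_mul_left {m n : ℕ} {a b c : G} (ha : a ∈ gammaSeries G m)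
    (hb : b ∈ gammaSeries G m) (hc : c ∈ gammaSeries G n) :
    grMk N (m + n) ⁅a * b, c⁆ (commutatorElement_mem_gammaSeries (mul_mem ha hb) hc) =
      grMk N (m + n) ⁅a, c⁆ (commutatorElement_mem_gammaSeries ha hc) +
      grMk N (m + n) ⁅b, c⁆ (commutatorElement_mem_gammaSeries hb hc) := by
  rw [← grMk_conj (commutatorElement_mem_gammaSeries hb hc) a, add_comm (grMk _ _ _ _), ← grMk_mul]
  congr 1
  exact commutatorElement_mul_left_eq_conj_mul a b c

theorem grMk_commutator_mul_right {m n : ℕ} {a b c : G} (ha : a ∈ gammaSeries G m)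
    (hb : b ∈ gammaSeries G n) (hc : c ∈ gammaSeries G n) :
    grMk N (m + n) ⁅a, b * c⁆ (commutatorElement_mem_gammaSeries ha (mul_mem hb hc)) =
      grMk N (m + n) ⁅a, b⁆ (commutatorElement_mem_gammaSeries ha hb) +
      grMk N (m + n) ⁅a, c⁆ (commutatorElement_mem_gammaSeries ha hc) := by
  rw [← grMk_conj (commutatorElement_mem_gammaSeries ha hc) b, ← grMk_mul]
  congr 1
  rw [commutatorElement_mul_right_eq_mul_conj]
  simp only [mul_assoc]

/-- The Lie bracket on homogeneous components, induced by the commutator. -/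
def grBracket {m n : ℕ} : GrComp G N m → GrComp G N n → GrComp G N (m + n) :=
  Quotient.map₂ (fun x y => ⟨⁅(x : G), (y : G)⁆, commutatorElement_mem_gammaSeries x.2 y.2⟩)
    fun x x' hx y y' hy => by
      rw [← Quotient.eq_iff_equiv] at hx hy ⊢
      have hx' := Subgroup.mem_subgroupOf.mp (QuotientGroup.eq.mp hx)
      have hy' := Subgroup.mem_subgroupOf.mp (QuotientGroup.eq.mp hy)
      push_cast at hx' hy'
      have hxm := mul_mem (inv_mem x.2) x'.2
      have hym := mul_mem (inv_mem y.2) y'.2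
      change grMk N (m + n) ⁅(x : G), (y : G)⁆ _ = grMk N (m + n) ⁅(x' : G), (y' : G)⁆ _
      have e1 := grMk_commutator_mul_left (N := N) x.2 hxm y'.2
      have e2 := grMk_commutator_mul_right (N := N) x.2 y.2 hym
      rw [grMk_eq_zero_iff.mpr (commutatorElement_mem_grDenom hx' y'.2), add_zero] at e1
      rw [grMk_eq_zero_iff.mpr (commutatorElement_mem_grDenom' x.2 hy'), add_zero] at e2
      simp only [mul_inv_cancel_left] at e1 e2
      rw [e1, e2]

theorem grBracket_add_left {m n : ℕ} (a b : GrComp G N m) (c : GrComp G N n) :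
    grBracket (a + b) c = grBracket a c + grBracket b c := by
  obtain ⟨a, ha, rfl⟩ := grMk_surjective a
  obtain ⟨b, hb, rfl⟩ := grMk_surjective b
  obtain ⟨c, hc, rfl⟩ := grMk_surjective c
  exact grMk_commutator_mul_left ha hb hc

theorem grBracket_add_right {m n : ℕ} (a : GrComp G N m) (b c : GrComp G N n) :
    grBracket a (b + c) = grBracket a b + grBracket a c := by
  obtain ⟨a, ha, rfl⟩ := grMk_surjective a
  obtain ⟨b, hb, rfl⟩ := grMk_surjective b
  obtain ⟨c, hc, rfl⟩ := grMk_surjective c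
  exact grMk_commutator_mul_right ha hb hc

instance : DirectSum.GNonUnitalNonAssocSemiring (GrComp G N) where
  mul := grBracket
  mul_zero a := by simpa using grBracket_add_right a 0 0
  zero_mul b := by simpa using grBracket_add_left 0 0 b
  mul_add := grBracket_add_right
  add_mul := grBracket_add_left

end Graded

open scoped DirectSum

/-- The associated graded Lie ring `⨁ γ_n / γ_{n+1}` of the lower central series, truncated above
degree `N`. Its bracket is the multiplication of Mathlib's direct sum of graded components. -/
abbrev GrLie (G : Type*) [Group G] (N : ℕ) : Type _ := ⨁ n, GrComp G N n

namespace GrLie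

variable {G : Type*} [Group G] {N : ℕ}

/-- The homogeneous element of degree `n` given by an element of `γ_n`. -/
def cls (N n : ℕ) (g : G) (hg : g ∈ gammaSeries G n) : GrLie G N :=
  DirectSum.of (GrComp G N) n (grMk N n g hg)

theorem cls_congr {m n : ℕ} (h : m = n) {g g' : G} (h' : g = g') (hg : g ∈ gammaSeries G m) :
    cls N m g hg = cls N n g' (h' ▸ h ▸ hg) := by
  subst h h'; rfl

theorem cls_mul {n : ℕ} {g h : G} (hg : g ∈ gammaSeries G n) (hh : h ∈ gammaSeries G n) :
    cls N n (g * h) (mul_mem hg hh) = cls N n g hg + cls N n h hh := by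
  rw [cls, grMk_mul, map_add]; rfl

theorem cls_one {n : ℕ} : cls N n (1 : G) (one_mem _) = 0 := by
  rw [cls, grMk_one, map_zero]

theorem cls_inv {n : ℕ} {g : G} (hg : g ∈ gammaSeries G n) :
    cls N n g⁻¹ (inv_mem hg) = -cls N n g hg := by
  rw [cls, grMk_inv, map_neg]; rfl

theorem cls_conj {n : ℕ} {g : G} (hg : g ∈ gammaSeries G n) (h : G) :
    cls N n (h * g * h⁻¹) ((gammaSeries_normal n).conj_mem g hg h) = cls N n g hg := by
  rw [cls, grMk_conj]; rfl

theorem cls_mul_cls {m n : ℕ} {x y : G} (hx : x ∈ gammaSeries G m) (hy : y ∈ gammaSeries G n) :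
    cls N m x hx * cls N n y hy =
      cls N (m + n) ⁅x, y⁆ (commutatorElement_mem_gammaSeries hx hy) :=
  DirectSum.of_mul_of _ _

theorem induction {P : GrLie G N → Prop} (x : GrLie G N) (zero : P 0)
    (cls : ∀ n g hg, P (cls N n g hg)) (add : ∀ x y, P x → P y → P (x + y)) : P x := by
  induction x using DirectSum.induction_on with
  | zero => exact zero
  | of n a =>
    obtain ⟨g, hg, rfl⟩ := grMk_surjective a
    exact cls n g hg
  | add x y hx hy => exact add x y hx hy

theorem mul_anticomm (x y : GrLie G N) : x * y = -(y * x) := by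
  induction x using induction with
  | zero => simp
  | add x x' hx hx' => rw [add_mul, mul_add, hx, hx', neg_add]
  | cls m g hg =>
    induction y using induction with
    | zero => simp
    | add y y' hy hy' => rw [add_mul, mul_add, hy, hy', neg_add]
    | cls n h hh =>
      rw [cls_mul_cls, cls_mul_cls, ← cls_inv]
      exact cls_congr (add_comm m n) (commutatorElement_inv h g).symm _

theorem mul_self_eq_zero' (x : GrLie G N) : x * x = 0 := by
  induction x using induction with
  | zero => simp
  | add x y hx hy => rw [add_mul, mul_add, mul_add, hx, hy, mul_anticomm x y]; simp
  | cls n g hg =>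
    rw [cls_mul_cls]
    exact (cls_congr rfl (commutatorElement_self g) _).trans cls_one

/-- The Jacobi identity, from the Hall–Witt identity. -/
theorem jacobi (x y z : GrLie G N) : y * (z * x) + z * (x * y) + x * (y * z) = 0 := by
  induction x using induction with
  | zero => simp
  | add x x' hx hx' =>
    simp only [add_mul, mul_add]
    rw [← add_zero (0 : GrLie G N)]
    nth_rewrite 1 [← hx]
    nth_rewrite 1 [← hx']
    abel
  | cls i a ha =>
  induction y using induction with
  | zero => simp
  | add x x' hx hx' =>
    simp only [add_mul, mul_add]
    rw [← add_zero (0 : GrLie G N)]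
    nth_rewrite 1 [← hx]
    nth_rewrite 1 [← hx']
    abel
  | cls j b hb =>
  induction z using induction with
  | zero => simp
  | add x x' hx hx' =>
    simp only [add_mul, mul_add]
    rw [← add_zero (0 : GrLie G N)]
    nth_rewrite 1 [← hx]
    nth_rewrite 1 [← hx']
    abel
  | cls k c hc =>
    have hb' := (gammaSeries_normal j).conj_mem b hb a
    have ha' := (gammaSeries_normal i).conj_mem a ha c
    have hc' := (gammaSeries_normal k).conj_mem c hc b
    have m1 := commutatorElement_mem_gammaSeries hb' (commutatorElement_mem_gammaSeries hc ha)
    have m2 := commutatorElement_mem_gammaSeries ha' (commutatorElement_mem_gammaSeries hb hc)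
    have m3 := commutatorElement_mem_gammaSeries hc' (commutatorElement_mem_gammaSeries ha hb)
    rw [show i + (j + k) = j + (k + i) by ring] at m2
    rw [show k + (i + j) = j + (k + i) by ring] at m3
    have h1 : cls N j b hb * (cls N k c hc * cls N i a ha) = cls N _ _ m1 := by
      rw [← cls_conj hb a, cls_mul_cls hc ha, cls_mul_cls hb' _]
    have h2 : cls N i a ha * (cls N j b hb * cls N k c hc) = cls N _ _ m2 := by
      rw [cls_mul_cls hb hc, ← cls_conj ha c, cls_mul_cls ha' _]
      exact cls_congr (by ring) rfl _
    have h3 : cls N k c hc * (cls N i a ha * cls N j b hb) = cls N _ _ m3 := by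
      rw [cls_mul_cls ha hb, ← cls_conj hc b, cls_mul_cls hc' _]
      exact cls_congr (by ring) rfl _
    have hW := commutatorElement_conj_commutatorElement_mul a b c
    rw [h1, h2, h3, add_right_comm, ← cls_mul, ← cls_mul]
    exact (cls_congr rfl hW _).trans cls_one

instance : LieRing (GrLie G N) where
  bracket x y := x * y
  add_lie := add_mul
  lie_add := mul_add
  lie_self := mul_self_eq_zero'
  leibniz_lie x y z := by
    change x * (y * z) = x * y * z + y * (x * z)
    have h := jacobi x y z
    rw [mul_anticomm (x * y) z, mul_anticomm x z, mul_neg]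
    rw [← sub_eq_zero, ← h]
    abel

theorem lie_eq_mul (x y : GrLie G N) : ⁅x, y⁆ = x * y := rfl

end GrLie

/-! ### Finiteness and solvability of the graded Lie ring -/

section GradedFinite

variable {G : Type*} [Group G] {N : ℕ}

theorem GrComp.subsingleton_of_lt {n : ℕ} (h : N < n) : Subsingleton (GrComp G N n) := by
  refine subsingleton_of_forall_eq 0 fun x => ?_
  obtain ⟨g, hg, rfl⟩ := grMk_surjective x
  rw [grMk_eq_zero_iff, grDenom, if_neg (by omega)]
  exact hg

instance GrComp.subsingleton_zero : Subsingleton (GrComp G N 0) := by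
  refine subsingleton_of_forall_eq 0 fun x => ?_
  obtain ⟨g, hg, rfl⟩ := grMk_surjective x
  rw [grMk_eq_zero_iff]
  exact gammaSeries_succ_le_grDenom 0 (mem_gammaSeries_one g)

theorem GrComp.finite_one [Group.FG G] : Module.Finite ℤ (GrComp G N 1) := by
  let f : Additive G →+ GrComp G N 1 :=
    { toFun := fun g => grMk N 1 g.toMul (mem_gammaSeries_one _)
      map_zero' := rfl
      map_add' := fun _ _ => rfl }
  have hf : Function.Surjective f := fun x => by
    obtain ⟨g, hg, rfl⟩ := grMk_surjective x
    exact ⟨.ofMul g, rfl⟩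
  rw [Module.Finite.iff_addGroup_fg]
  exact AddGroup.fg_of_surjective hf

instance GrComp.finite [Group.FG G] (n : ℕ) : Module.Finite ℤ (GrComp G N n) := by
  match n with
  | 0 => infer_instance
  | n + 1 =>
  induction n with
  | zero => exact GrComp.finite_one
  | succ n ih =>
    let B : GrComp G N (n + 1) →ₗ[ℤ] GrComp G N 1 →ₗ[ℤ] GrComp G N (n + 1 + 1) :=
      LinearMap.mk₂ ℤ grBracket grBracket_add_left
        (fun c x y => map_zsmul (AddMonoidHom.mk' (grBracket · y) (grBracket_add_left · · y)) c x)
        grBracket_add_right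
        (fun c x y => map_zsmul (AddMonoidHom.mk' (grBracket x) (grBracket_add_right x)) c y)
    refine ⟨?_⟩
    suffices h : Submodule.map₂ B ⊤ ⊤ = ⊤ by
      rw [← h]
      exact Submodule.FG.map₂ B ih.fg_top GrComp.finite_one.fg_top
    refine Submodule.eq_top_iff'.mpr fun x => ?_
    obtain ⟨g, hg, rfl⟩ := grMk_surjective x
    induction g, hg using gammaSeries_induction with
    | comm x hx y =>
      exact Submodule.apply_mem_map₂ B (m := grMk N (n + 1) x hx)
        (n := grMk N 1 y (mem_gammaSeries_one y)) Submodule.mem_top Submodule.mem_top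
    | one => exact zero_mem _
    | mul x y hx hy h h' => exact add_mem h h'
    | inv x hx h => exact neg_mem h

instance GrLie.finite [Group.FG G] : Module.Finite ℤ (GrLie G N) := by
  refine ⟨?_⟩
  have h : (⨆ n ∈ Finset.range (N + 1),
      LinearMap.range (DirectSum.lof ℤ ℕ (GrComp G N) n)) = ⊤ := by
    refine Submodule.eq_top_iff'.mpr fun x => ?_
    induction x using DirectSum.induction_on with
    | zero => exact zero_mem _
    | add x y hx hy => exact add_mem hx hy
    | of n a =>
      by_cases hn : n < N + 1
      · exact Submodule.mem_iSup_of_mem n (Submodule.mem_iSup_of_mem (Finset.mem_range.mpr hn)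
          ⟨a, rfl⟩)
      · have := GrComp.subsingleton_of_lt (G := G) (N := N) (n := n) (by omega)
        rw [Subsingleton.elim a 0, map_zero]
        exact zero_mem _
  rw [← h]
  refine Submodule.fg_biSup _ _ fun n _ => ?_
  rw [LinearMap.range_eq_map]
  exact Module.Finite.fg_top.map _

namespace GrLie

variable (G N) in
/-- The elements concentrated in degrees at least `k`. -/
def degreeGE (k : ℕ) : Submodule ℤ (GrLie G N) :=
  Submodule.span ℤ {x | ∃ n, k ≤ n ∧ ∃ a : GrComp G N n, x = DirectSum.of _ n a}

theorem mul_mem_degreeGE {k l : ℕ} {x y : GrLie G N} (hx : x ∈ degreeGE G N k)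
    (hy : y ∈ degreeGE G N l) : x * y ∈ degreeGE G N (k + l) := by
  induction hx, hy using Submodule.span_induction₂ with
  | mem_mem x y hx hy =>
    obtain ⟨m, hm, a, rfl⟩ := hx
    obtain ⟨n, hn, b, rfl⟩ := hy
    rw [DirectSum.of_mul_of]
    exact Submodule.subset_span ⟨m + n, by omega, _, rfl⟩
  | zero_left y _ => rw [zero_mul]; exact zero_mem _
  | zero_right x _ => rw [mul_zero]; exact zero_mem _
  | add_left x y z _ _ _ h h' => rw [add_mul]; exact add_mem h h'
  | add_right x y z _ _ _ h h' => rw [mul_add]; exact add_mem h h'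
  | smul_left r x y _ _ h => rw [smul_mul_assoc]; exact Submodule.smul_mem _ _ h
  | smul_right r x y _ _ h => rw [mul_smul_comm]; exact Submodule.smul_mem _ _ h

theorem degreeGE_one : degreeGE G N 1 = ⊤ := by
  refine Submodule.eq_top_iff'.mpr fun x => ?_
  induction x using DirectSum.induction_on with
  | zero => exact zero_mem _
  | add x y hx hy => exact add_mem hx hy
  | of n a =>
    rcases n with _ | n
    · rw [Subsingleton.elim a 0, map_zero]
      exact zero_mem _
    · exact Submodule.subset_span ⟨n + 1, by omega, a, rfl⟩

theorem degreeGE_of_lt {k : ℕ} (h : N < k) : degreeGE G N k = ⊥ := by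
  rw [degreeGE, Submodule.span_eq_bot]
  rintro _ ⟨n, hn, a, rfl⟩
  have := GrComp.subsingleton_of_lt (G := G) (h.trans_le hn)
  rw [Subsingleton.elim a 0, map_zero]

theorem degreeGE_antitone : Antitone (degreeGE G N) := fun _ _ h =>
  Submodule.span_mono fun _ ⟨n, hn, a⟩ => ⟨n, h.trans hn, a⟩

instance isSolvable : LieAlgebra.IsSolvable (GrLie G N) := by
  refine LieAlgebra.IsSolvable.mk (R := ℤ) (k := N) ?_
  have key (k : ℕ) : (LieAlgebra.derivedSeries ℤ (GrLie G N) k).toSubmodule ≤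
      degreeGE G N (k + 1) := by
    induction k with
    | zero => rw [degreeGE_one]; exact le_top
    | succ k ih =>
      rw [LieAlgebra.derivedSeries_def, LieAlgebra.derivedSeriesOfIdeal_succ,
        LieSubmodule.lieIdeal_oper_eq_linear_span', Submodule.span_le]
      rintro _ ⟨x, hx, y, hy, rfl⟩
      exact degreeGE_antitone (by omega) (mul_mem_degreeGE (ih hx) (ih hy))
  rw [← LieSubmodule.toSubmodule_eq_bot, ← le_bot_iff]
  exact (key N).trans (degreeGE_of_lt N.lt_succ_self).le

end GrLie
end GradedFinite

/-! ### The lower central series of a right angled Artin group is isolated -/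

open scoped TensorProduct in
theorem map_eq_zero_of_one_tmul_eq_zero {R A L Q : Type*} [CommRing R] [CommRing A] [Algebra R A]
    [AddCommGroup L] [Module R L] [AddCommGroup Q] [Module R Q] [Module A Q] [IsScalarTower R A Q]
    (f : L →ₗ[R] Q) {x : L} (h : (1 : A) ⊗ₜ[R] x = 0) : f x = 0 := by
  have h2 : LinearMap.liftBaseChange A f ((1 : A) ⊗ₜ[R] x) = 0 := by
    rw [h, map_zero]
  rwa [LinearMap.liftBaseChange_tmul, one_smul] at h2

open scoped TensorProduct in
/-- A solvable Lie ring with finitely generated additive group embeds modulo any prime `p` into an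
associative ring. -/
theorem LieRing.exists_hom_associative_ker_le_smul.{u} (p : ℕ) [Fact p.Prime]
    (L : Type u) [LieRing L]
    [Module.Finite ℤ L] [LieAlgebra.IsSolvable L] :
    ∃ (U : Type u) (_ : Ring U) (φ : L →+ U), (∀ x y, φ ⁅x, y⁆ = ⁅φ x, φ y⁆) ∧
      ∀ x, φ x = 0 → ∃ y, x = p • y := by
  refine ⟨UniversalEnvelopingAlgebra (ZMod p) (ZMod p ⊗[ℤ] L), inferInstance,
    (UniversalEnvelopingAlgebra.ι (ZMod p) (L := ZMod p ⊗[ℤ] L)).toLinearMap.toAddMonoidHom.comp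
      (TensorProduct.mk ℤ (ZMod p) L 1).toAddMonoidHom, fun x y => ?_, fun x hx => ?_⟩
  · change UniversalEnvelopingAlgebra.ι (ZMod p) ((1 : ZMod p) ⊗ₜ[ℤ] ⁅x, y⁆) =
      ⁅UniversalEnvelopingAlgebra.ι (ZMod p) ((1 : ZMod p) ⊗ₜ[ℤ] x),
        UniversalEnvelopingAlgebra.ι (ZMod p) ((1 : ZMod p) ⊗ₜ[ℤ] y)⁆
    rw [← LieHom.map_lie, LieAlgebra.ExtendScalars.bracket_tmul, one_mul]
  · have h1 : (1 : ZMod p) ⊗ₜ[ℤ] x = 0 :=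
      (injective_iff_map_eq_zero _).mp
        (UniversalEnvelopingAlgebra.ι_injective_of_isSolvable (ZMod p) (ZMod p ⊗[ℤ] L)) _ hx
    let P : Submodule ℤ L := LinearMap.range (LinearMap.lsmul ℤ L p)
    have hP (q : L ⧸ P) : p • q = 0 := by
      obtain ⟨y, rfl⟩ := P.mkQ_surjective q
      rw [← map_nsmul, Submodule.mkQ_apply, Submodule.Quotient.mk_eq_zero]
      exact ⟨y, by simp⟩
    let := AddCommGroup.zmodModule hP
    have h2 := map_eq_zero_of_one_tmul_eq_zero (A := ZMod p) P.mkQ h1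
    rw [Submodule.mkQ_apply, Submodule.Quotient.mk_eq_zero] at h2
    obtain ⟨y, hy⟩ := h2
    exact ⟨y, by simpa using hy.symm⟩

/-- A submodule of a finitely generated abelian group that is `p`-divisible for all primes `p`
vanishes. -/
theorem Submodule.eq_zero_of_forall_prime_divisible {M : Type*} [AddCommGroup M]
    [Module.Finite ℤ M] (K : Submodule ℤ M)
    (hK : ∀ p : ℕ, p.Prime → ∀ x ∈ K, ∃ y ∈ K, x = p • y) {x : M} (hx : x ∈ K) : x = 0 := by
  -- By Nakayama's lemma for `2`, some odd integer `r` annihilates `K`; but `K` is `r`-divisible.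
  obtain ⟨r, hr, hr0⟩ := Submodule.exists_sub_one_mem_and_smul_eq_zero_of_fg_of_le_smul
    (Ideal.span {(2 : ℤ)}) K (IsNoetherian.noetherian K) fun x hx => by
      obtain ⟨y, hy, rfl⟩ := hK 2 Nat.prime_two x hx
      rw [← natCast_zsmul]
      exact Submodule.smul_mem_smul (Ideal.mem_span_singleton_self _) hy
  have hdiv (m : ℕ) : m ≠ 0 → ∀ x ∈ K, ∃ y ∈ K, x = m • y := by
    induction m using Nat.recOnMul with
    | zero => exact fun h => absurd rfl h
    | one => exact fun _ x hx => ⟨x, hx, (one_smul _ _).symm⟩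
    | prime p hp => exact fun _ => hK p hp
    | mul a b iha ihb =>
      intro h x hx
      obtain ⟨y, hy, rfl⟩ := iha (left_ne_zero_of_mul h) x hx
      obtain ⟨z, hz, rfl⟩ := ihb (right_ne_zero_of_mul h) y hy
      exact ⟨z, hz, (mul_smul _ _ _).symm⟩
  have hr' : r.natAbs ≠ 0 := by
    rintro h
    rw [Int.natAbs_eq_zero] at h
    rw [h, Ideal.mem_span_singleton] at hr
    omega
  obtain ⟨y, hy, rfl⟩ := hdiv _ hr' x hx
  have := hr0 y hy
  rw [← natCast_zsmul]
  rcases Int.natAbs_eq r with h | h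
  · rwa [← h]
  · rw [h, neg_smul, neg_eq_zero] at this
    exact this

namespace RAAG

open PowerSeries

variable {V : Type*} (Γ : SimpleGraph V)

/-- The congruence on words in the vertices that is generated by swapping adjacent letters which
span an edge. -/
def traceCon : Con (FreeMonoid V) :=
  conGen fun x y => ∃ v w, Γ.Adj v w ∧
    x = FreeMonoid.of v * FreeMonoid.of w ∧ y = FreeMonoid.of w * FreeMonoid.of v

/-- The trace monoid of a graph: words in the vertices, up to commutation along the edges. -/
abbrev TraceMonoid : Type _ := (traceCon Γ).Quotient

/-- The generator of the trace monoid ring given by a vertex. -/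
noncomputable def traceVar (v : V) : MonoidAlgebra ℤ (TraceMonoid Γ) :=
  MonoidAlgebra.of ℤ _ ((FreeMonoid.of v : FreeMonoid V) : TraceMonoid Γ)

variable {Γ}

theorem commute_traceVar (v w : V) (h : Γ.Adj v w) : Commute (traceVar Γ v) (traceVar Γ w) := by
  rw [commute_iff_eq, traceVar, traceVar, ← map_mul, ← map_mul]
  congr 1
  exact (Con.eq _).mpr (ConGen.Rel.of _ _ ⟨v, w, h, rfl, rfl⟩)

/-- The trace monoid ring is universal among rings with elements `b_v` commuting along the edges. -/
theorem exists_traceVar_hom {B : Type*} [Ring B] (b : V → B)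
    (hb : ∀ v w, Γ.Adj v w → Commute (b v) (b w)) :
    ∃ h : MonoidAlgebra ℤ (TraceMonoid Γ) →+* B, ∀ v, h (traceVar Γ v) = b v := by
  refine ⟨MonoidAlgebra.lift ℤ B _ (Con.lift (traceCon Γ) (FreeMonoid.lift b) (Con.conGen_le.mpr ?_)),
    fun v => ?_⟩
  · rintro x y ⟨v, w, h, rfl, rfl⟩
    simpa [Con.ker_rel] using (hb v w h).eq
  · rw [RingHom.coe_coe, traceVar, MonoidAlgebra.lift_of]
    exact FreeMonoid.lift_eval_of b v

section Graded

variable {N : ℕ} {A : Type*} [Ring A] (φ : GrLie (RAAG Γ) N →+ A)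

theorem commute_of_lieHom (hφ : ∀ x y, φ ⁅x, y⁆ = ⁅φ x, φ y⁆) (v w : V) (h : Γ.Adj v w) :
    Commute (φ (GrLie.cls N 1 (PresentedGroup.of v) (mem_gammaSeries_one _)))
      (φ (GrLie.cls N 1 (PresentedGroup.of w) (mem_gammaSeries_one _))) := by
  rw [commute_iff_eq, ← sub_eq_zero, ← LieRing.of_associative_ring_bracket, ← hφ,
    GrLie.lie_eq_mul, GrLie.cls_mul_cls,
    GrLie.cls_congr rfl (commutatorElement_eq_one_iff_commute.mpr (commute_of_adj h)),
    GrLie.cls_one, map_zero]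

/-- The leading coefficients of the Magnus representation attached to a Lie homomorphism `φ` from
the graded Lie ring to an associative ring are the values of `φ`. -/
theorem coeff_magnus_eq_lieHom (hφ : ∀ x y, φ ⁅x, y⁆ = ⁅φ x, φ y⁆) {n : ℕ} {g : RAAG Γ}
    (hg : g ∈ gammaSeries (RAAG Γ) (n + 1)) :
    coeff (n + 1) (magnus ℤ _ (commute_of_lieHom φ hφ) g : PowerSeries A) =
      φ (GrLie.cls N (n + 1) g hg) := by
  have hmul {n : ℕ} {x y : RAAG Γ} (hx : x ∈ gammaSeries (RAAG Γ) (n + 1))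
      (hy : y ∈ gammaSeries (RAAG Γ) (n + 1))
      (h : coeff (n + 1) (magnus ℤ _ (commute_of_lieHom φ hφ) x : PowerSeries A) =
        φ (GrLie.cls N (n + 1) x hx))
      (h' : coeff (n + 1) (magnus ℤ _ (commute_of_lieHom φ hφ) y : PowerSeries A) =
        φ (GrLie.cls N (n + 1) y hy)) :
      coeff (n + 1) (magnus ℤ _ (commute_of_lieHom φ hφ) (x * y) : PowerSeries A) =
        φ (GrLie.cls N (n + 1) (x * y) (mul_mem hx hy)) := by
    rw [map_mul, coeff_mul_of_mem_congruenceUnits n.succ_pos (magnus_mem_congruenceUnits _ hx)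
      (magnus_mem_congruenceUnits _ hy), h, h', GrLie.cls_mul, map_add]
  have hinv {n : ℕ} {x : RAAG Γ} (hx : x ∈ gammaSeries (RAAG Γ) (n + 1))
      (h : coeff (n + 1) (magnus ℤ _ (commute_of_lieHom φ hφ) x : PowerSeries A) =
        φ (GrLie.cls N (n + 1) x hx)) :
      coeff (n + 1) (magnus ℤ _ (commute_of_lieHom φ hφ) x⁻¹ : PowerSeries A) =
        φ (GrLie.cls N (n + 1) x⁻¹ (inv_mem hx)) := by
    rw [GrLie.cls_inv hx, map_neg, ← h, eq_neg_iff_add_eq_zero,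
      ← coeff_mul_of_mem_congruenceUnits n.succ_pos (magnus_mem_congruenceUnits _ (inv_mem hx))
      (magnus_mem_congruenceUnits _ hx), ← map_mul, inv_mul_cancel, map_one]
    simp [coeff_one]
  have hone {n : ℕ} : coeff (n + 1) (magnus ℤ _ (commute_of_lieHom φ hφ) 1 : PowerSeries A) =
        φ (GrLie.cls N (n + 1) (1 : RAAG Γ) (one_mem _)) := by
    rw [GrLie.cls_one, map_zero, map_one]
    simp [coeff_one]
  have h1 (g : RAAG Γ) (hg : g ∈ gammaSeries (RAAG Γ) 1) :
      coeff 1 (magnus ℤ _ (commute_of_lieHom φ hφ) g : PowerSeries A) =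
        φ (GrLie.cls N 1 g hg) := by
    have hg' : g ∈ Subgroup.closure (Set.range (PresentedGroup.of : V → RAAG Γ)) := by
      rw [closure_range_of]; trivial
    induction hg' using Subgroup.closure_induction with
    | mem x hx =>
      obtain ⟨v, rfl⟩ := hx
      rw [val_magnus_of]
      simp [coeff_one]
    | one => exact hone
    | mul x y _ _ h h' =>
      exact hmul (mem_gammaSeries_one x) (mem_gammaSeries_one y) (h (mem_gammaSeries_one x))
        (h' (mem_gammaSeries_one y))
    | inv x _ h => exact hinv (mem_gammaSeries_one x) (h (mem_gammaSeries_one x))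
  induction n generalizing g with
  | zero => exact h1 g hg
  | succ n ih =>
    induction g, hg using gammaSeries_induction with
    | comm x hx y =>
      rw [map_commutatorElement, coeff_commutatorElement n.succ_pos one_pos
        (magnus_mem_congruenceUnits _ hx) (magnus_mem_congruenceUnits_one _ y), ih hx,
        h1 y (mem_gammaSeries_one y), ← hφ, GrLie.lie_eq_mul, GrLie.cls_mul_cls]
    | one => exact hone
    | mul x y hx hy h h' => exact hmul hx hy h h'
    | inv x hx h => exact hinv hx h

end Graded

variable (Γ) in
/-- The leading coefficient of the universal Magnus representation on `γ_{n+1}`. -/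
noncomputable def leadingTermHom (n : ℕ) :
    gammaSeries (RAAG Γ) (n + 1) →* Multiplicative (MonoidAlgebra ℤ (TraceMonoid Γ)) :=
  (leadingCoeffHom (MonoidAlgebra ℤ (TraceMonoid Γ)) n.succ_pos).comp
    (((magnus ℤ (traceVar Γ) commute_traceVar).comp
      (gammaSeries (RAAG Γ) (n + 1)).subtype).codRestrict _
        fun g => magnus_mem_congruenceUnits commute_traceVar g.2)

variable (Γ) in
/-- The leading coefficient of the universal Magnus representation, as a map from
`γ_{n+1} / γ_{n+2}` to the trace monoid ring. -/
noncomputable def leadingTerm (n : ℕ) :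
    GrComp (RAAG Γ) (n + 1) (n + 1) →+ MonoidAlgebra ℤ (TraceMonoid Γ) :=
  MonoidHom.toAdditiveLeft (β := MonoidAlgebra ℤ (TraceMonoid Γ)) <|
    QuotientGroup.lift _ (leadingTermHom Γ n) fun g hg => by
      rw [Subgroup.mem_subgroupOf, grDenom, if_pos le_rfl] at hg
      have h := coeff_eq_zero_of_mem_congruenceUnits_succ n.succ_pos
        (magnus_mem_congruenceUnits (R := ℤ) commute_traceVar hg)
      exact congrArg (Multiplicative.ofAdd (α := MonoidAlgebra ℤ (TraceMonoid Γ))) h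

theorem leadingTerm_grMk {n : ℕ} {g : RAAG Γ} (hg : g ∈ gammaSeries (RAAG Γ) (n + 1)) :
    leadingTerm Γ n (grMk (n + 1) (n + 1) g hg) =
      coeff (n + 1) (magnus ℤ (traceVar Γ) commute_traceVar g :
        PowerSeries (MonoidAlgebra ℤ (TraceMonoid Γ))) := rfl

/-- The graded Lie ring of the lower central series embeds into the trace monoid ring. -/
theorem leadingTerm_injective [Finite V] (n : ℕ) : Function.Injective (leadingTerm Γ n) := by
  have := fg (Γ := Γ)
  rw [injective_iff_map_eq_zero]
  intro x hx
  refine (leadingTerm Γ n).toIntLinearMap.ker.eq_zero_of_forall_prime_divisible ?_ hx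
  intro p hp x hx
  have := Fact.mk hp
  obtain ⟨U, _, φ, hφ, hker⟩ :=
    LieRing.exists_hom_associative_ker_le_smul p (GrLie (RAAG Γ) (n + 1))
  obtain ⟨h, hh⟩ := exists_traceVar_hom _ (commute_of_lieHom φ hφ)
  obtain ⟨g, hg, rfl⟩ := grMk_surjective x
  obtain ⟨y, hy⟩ := hker (GrLie.cls (n + 1) (n + 1) g hg) <| by
    rw [← coeff_magnus_eq_lieHom φ hφ hg, map_coeff_magnus (R := ℤ) commute_traceVar h _ hh,
      ← leadingTerm_grMk hg]
    exact (congrArg h hx).trans (map_zero h)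
  have hy' : grMk (n + 1) (n + 1) g hg = p • y (n + 1) := by
    have := congrArg (fun z : GrLie (RAAG Γ) (n + 1) => z (n + 1)) hy
    simpa [GrLie.cls, DirectSum.smul_apply] using this
  refine ⟨y (n + 1), ?_, hy'⟩
  have hx' : leadingTerm Γ n (grMk (n + 1) (n + 1) g hg) = 0 := hx
  rw [hy', map_nsmul, ← natCast_zsmul, smul_eq_zero] at hx'
  exact hx'.resolve_left (by exact_mod_cast hp.ne_zero)

theorem mem_gammaSeries_of_zpow_mem_of_finite [Finite V] {n : ℕ} {g : RAAG Γ} {k : ℤ} (hk : k ≠ 0)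
    (hg : g ^ k ∈ gammaSeries (RAAG Γ) n) : g ∈ gammaSeries (RAAG Γ) n := by
  match n with
  | 0 => exact Subgroup.mem_top g
  | n + 1 =>
  induction n with
  | zero => exact Subgroup.mem_top g
  | succ n ih =>
    have hg' := ih (gammaSeries_antitone n.succ.le_succ hg)
    have h0 : k • grMk (n + 1) (n + 1) g hg' = 0 :=
      (grMk_eq_zero_iff (g := g ^ k) (hg := zpow_mem hg' k)).mpr (by rwa [grDenom, if_pos le_rfl])
    have h1 : leadingTerm Γ n (grMk (n + 1) (n + 1) g hg') = 0 := by
      have h2 := congrArg (leadingTerm Γ n) h0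
      rw [map_zsmul, map_zero, smul_eq_zero] at h2
      exact h2.resolve_left hk
    have h3 := (injective_iff_map_eq_zero _).mp (leadingTerm_injective n) _ h1
    rwa [grMk_eq_zero_iff, grDenom, if_pos le_rfl] at h3

end RAAG

/-! ### Reduced words -/

namespace RAAG

variable {V : Type*} {Γ : SimpleGraph V}

variable (Γ) in
/-- The element of the right angled Artin group represented by a word in syllables `v ^ e`. -/
def wordProd (l : List (V × ℤ)) : RAAG Γ :=
  (l.map fun x => (PresentedGroup.of x.1 : RAAG Γ) ^ x.2).prod

@[simp]
theorem wordProd_nil : wordProd Γ [] = 1 := rfl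

@[simp]
theorem wordProd_cons (x : V × ℤ) (l : List (V × ℤ)) :
    wordProd Γ (x :: l) = (PresentedGroup.of x.1 : RAAG Γ) ^ x.2 * wordProd Γ l := by
  simp [wordProd]

@[simp]
theorem wordProd_append (l l' : List (V × ℤ)) :
    wordProd Γ (l ++ l') = wordProd Γ l * wordProd Γ l' := by
  simp [wordProd]

theorem exists_wordProd_eq (g : RAAG Γ) : ∃ l, wordProd Γ l = g := by
  have hg : g ∈ Subgroup.closure (Set.range (PresentedGroup.of : V → RAAG Γ)) := by
    rw [closure_range_of]; trivial
  induction hg using Subgroup.closure_induction_left with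
  | one => exact ⟨[], rfl⟩
  | mul_left x hx y _ h =>
    obtain ⟨v, rfl⟩ := hx
    obtain ⟨l, rfl⟩ := h
    exact ⟨(v, 1) :: l, by simp⟩
  | inv_mul_cancel x hx y _ h =>
    obtain ⟨v, rfl⟩ := hx
    obtain ⟨l, rfl⟩ := h
    exact ⟨(v, -1) :: l, by simp⟩

variable (Γ) in
/-- A word in syllables is reduced if its exponents are nonzero and two syllables of the same letter
`v` are always separated by a letter that neither equals `v` nor commutes with it. -/
structure IsReduced (l : List (V × ℤ)) : Prop where
  exponent_ne_zero : ∀ x ∈ l, x.2 ≠ 0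
  exists_separating : ∀ v e m e' s, (v, e) :: (m ++ (v, e') :: s) <:+ l →
    ∃ x ∈ m, x.1 ≠ v ∧ ¬ Γ.Adj v x.1

theorem commute_wordProd {v : V} {m : List (V × ℤ)} (h : ∀ x ∈ m, x.1 ≠ v → Γ.Adj v x.1) :
    Commute (PresentedGroup.of v : RAAG Γ) (wordProd Γ m) := by
  induction m with
  | nil => exact Commute.one_right _
  | cons x m ih =>
    rw [wordProd_cons]
    refine Commute.mul_right (Commute.zpow_right ?_ _) (ih fun y hy => h y (by simp [hy]))
    by_cases hx : x.1 = v
    · rw [hx]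
    · exact commute_of_adj (h x (by simp) hx)

/-- A word with the least number of syllables is reduced. -/
theorem exists_isReduced_wordProd_eq (g : RAAG Γ) : ∃ l, IsReduced Γ l ∧ wordProd Γ l = g := by
  obtain ⟨l, rfl, hmin⟩ : ∃ l, wordProd Γ l = g ∧
      ∀ l', wordProd Γ l' = g → l.length ≤ l'.length := by
    have h : {l | wordProd Γ l = g}.Nonempty := exists_wordProd_eq g
    exact ⟨Function.argminOn List.length _ h, Function.argminOn_mem _ _ h,
      fun l' hl' => Function.argminOn_le List.length _ hl'⟩
  refine ⟨l, ⟨fun x hx hx0 => ?_, fun v e m e' s hs => ?_⟩, rfl⟩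
  · obtain ⟨p, t, rfl⟩ := List.append_of_mem hx
    have := hmin (p ++ t) (by simp [hx0])
    simp at this
  · by_contra! h
    obtain ⟨p, rfl⟩ := hs
    have hcomm := (commute_wordProd h).zpow_left e'
    have := hmin (p ++ (v, e + e') :: (m ++ s)) (by
      simp only [wordProd_append, wordProd_cons, zpow_add, mul_assoc]
      rw [← mul_assoc (wordProd Γ m), ← hcomm.eq, mul_assoc])
    simp at this

/-! ### Modular representations that detect reduced words -/

section Detect

open scoped Classical in
/-- The total number of letters `v` in a word, where a syllable `v ^ e` counts as `c e` letters. -/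
noncomputable def letterCount (c : ℤ → ℕ) (s : List (V × ℤ)) (v : V) : ℕ :=
  (s.map fun x => if x.1 = v then c x.2 else 0).sum

variable {c : ℤ → ℕ}

theorem letterCount_cons_self (v : V) (e : ℤ) (s : List (V × ℤ)) :
    letterCount c ((v, e) :: s) v = letterCount c s v + c e := by
  simp [letterCount, add_comm]

theorem letterCount_cons_of_ne {v w : V} (h : w ≠ v) (e : ℤ) (s : List (V × ℤ)) :
    letterCount c ((v, e) :: s) w = letterCount c s w := by
  simp [letterCount, h.symm]

theorem letterCount_append (s t : List (V × ℤ)) (v : V) :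
    letterCount c (s ++ t) v = letterCount c s v + letterCount c t v := by
  simp [letterCount]

theorem letterCount_le_of_suffix {s t : List (V × ℤ)} (h : s <:+ t) (v : V) :
    letterCount c s v ≤ letterCount c t v := by
  obtain ⟨p, rfl⟩ := h
  rw [letterCount_append]
  exact Nat.le_add_left _ _

theorem letterCount_pos_of_mem {s : List (V × ℤ)} {x : V × ℤ} (h : x ∈ s) (hx : 0 < c x.2) :
    0 < letterCount c s x.1 := by
  obtain ⟨p, t, rfl⟩ := List.append_of_mem h
  have := letterCount_cons_self (c := c) x.1 x.2 t
  rw [letterCount_append, this]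
  omega

variable (Γ c) in
/-- A state records how many letters of each kind have been applied. Given a word `l`, the letter
`v` may be applied to the state `n` if some syllable `(v, e)` of `l` is under way: the letters `v`
to the right of this syllable have all been applied, those of the syllable not all, and
for the other letters that do not commute with `v`, exactly those to the right of the syllable have
been applied. -/
def Addable (l : List (V × ℤ)) (v : V) (n : V → ℕ) : Prop :=
  ∃ e s, (v, e) :: s <:+ l ∧ letterCount c s v ≤ n v ∧ n v < letterCount c s v + c e ∧
    ∀ w, w ≠ v → ¬ Γ.Adj v w → n w = letterCount c s w

theorem addable_congr {l : List (V × ℤ)} {v : V} {n n' : V → ℕ} (h : n v = n' v)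
    (h' : ∀ w, w ≠ v → ¬ Γ.Adj v w → n w = n' w) : Addable Γ c l v n ↔ Addable Γ c l v n' := by
  unfold Addable
  rw [h]
  refine exists₂_congr fun e s => and_congr_right' (and_congr_right' (and_congr_right' ?_))
  exact forall₃_congr fun w hw hw' => by rw [h' w hw hw']

section

variable {l : List (V × ℤ)}

open scoped Classical

/-- Applying the letter of the leftmost syllable of a suffix does not lead out of the states below
the letter count of the suffix. -/
theorem add_single_le_letterCount (hl : IsReduced Γ l) (hc : ∀ e ≠ 0, 0 < c e) {v : V} {e : ℤ}
    {s : List (V × ℤ)} (hs : (v, e) :: s <:+ l) {n : V → ℕ}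
    (hn : n ≤ letterCount c ((v, e) :: s)) (h : Addable Γ c l v n) :
    n + Pi.single v 1 ≤ letterCount c ((v, e) :: s) := by
  obtain ⟨e', s', hs', -, hlt, heq⟩ := h
  have key (hsuf : (v, e') :: s' <:+ (v, e) :: s) :
      n + Pi.single v 1 ≤ letterCount c ((v, e) :: s) := by
    intro w
    by_cases hw : w = v
    · subst hw
      have := letterCount_le_of_suffix (c := c) hsuf w
      rw [letterCount_cons_self] at this
      simp only [Pi.add_apply, Pi.single_eq_same]
      omega
    · simpa [hw] using hn w
  rcases List.suffix_or_suffix_of_suffix hs' hs with h | h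
  · exact key h
  · rcases List.suffix_cons_iff.mp h with h | ⟨m, rfl⟩
    · exact key (h ▸ List.suffix_rfl)
    · obtain ⟨x, hx, hxv, hadj⟩ := hl.exists_separating v e' m e s hs'
      have h1 := heq x.1 hxv hadj
      have h2 : n x.1 ≤ letterCount c ((v, e) :: s) x.1 := hn x.1
      have h3 := letterCount_pos_of_mem hx (hc _ (hl.exponent_ne_zero x
        (hs'.mem (by simp [hx]))))
      rw [letterCount_append] at h1
      omega

theorem add_nsmul_single_le_letterCount (hl : IsReduced Γ l) (hc : ∀ e ≠ 0, 0 < c e) {v : V} {e : ℤ}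
    {s : List (V × ℤ)} (hs : (v, e) :: s <:+ l) {n : V → ℕ}
    (hn : n ≤ letterCount c s) {b : ℕ} (h : ∀ r < b, Addable Γ c l v (n + r • Pi.single v 1)) :
    n + b • Pi.single v 1 ≤ letterCount c ((v, e) :: s) := by
  induction b with
  | zero =>
    rw [zero_smul, add_zero]
    exact fun w => (hn w).trans (letterCount_le_of_suffix (List.suffix_cons _ _) w)
  | succ b ih =>
    rw [succ_nsmul, ← add_assoc]
    exact add_single_le_letterCount hl hc hs (ih fun r hr => h r (by omega)) (h b (by omega))

/-- The letter count of a suffix is reached only by completing its syllables one by one. -/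
theorem eq_of_add_nsmul_single_eq_letterCount (hl : IsReduced Γ l) (hc : ∀ e ≠ 0, 0 < c e) {v : V}
    {e : ℤ} {s : List (V × ℤ)} (hs : (v, e) :: s <:+ l) {n : V → ℕ}
    (hn : n ≤ letterCount c s) {b : ℕ} (h : ∀ r < b, Addable Γ c l v (n + r • Pi.single v 1))
    (hb : n + b • Pi.single v 1 = letterCount c ((v, e) :: s)) :
    b = c e ∧ n = letterCount c s := by
  have hne (w : V) (hw : w ≠ v) : n w = letterCount c s w := by
    have := congrFun hb w
    rw [letterCount_cons_of_ne hw] at this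
    simpa [hw] using this
  have hv : n v + b = letterCount c s v + c e := by
    have := congrFun hb v
    rw [letterCount_cons_self] at this
    simpa using this
  have hnv : n v ≤ letterCount c s v := hn v
  rcases hnv.eq_or_lt with hv' | hlt
  · refine ⟨by omega, funext fun w => ?_⟩
    by_cases hw : w = v
    · rw [hw, hv']
    · exact hne w hw
  exfalso
  obtain ⟨e', s', hs', hle, -, heq⟩ := h 0 (by omega)
  simp only [zero_smul, add_zero] at hle heq
  rcases List.suffix_or_suffix_of_suffix hs' hs with h | h <;>
    rcases List.suffix_cons_iff.mp h with h | h
  · obtain rfl := (List.cons.inj h).2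
    omega
  · obtain ⟨m, rfl⟩ := h
    obtain ⟨x, hx, hxv, hadj⟩ := hl.exists_separating v e m e' s' hs
    have h1 := heq x.1 hxv hadj
    have h2 := hne x.1 hxv
    have h3 := letterCount_pos_of_mem hx (hc _ (hl.exponent_ne_zero x (hs.mem (by simp [hx]))))
    rw [letterCount_append, letterCount_cons_of_ne hxv] at h2
    omega
  · obtain rfl := (List.cons.inj h).2
    omega
  · have := letterCount_le_of_suffix (c := c) ((List.suffix_cons _ _).trans h) v
    omega

theorem addable_letterCount_add {v : V} {e : ℤ} {s : List (V × ℤ)} (hs : (v, e) :: s <:+ l)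
    {r : ℕ} (hr : r < c e) : Addable Γ c l v (letterCount c s + r • Pi.single v 1) := by
  refine ⟨e, s, hs, by simp, by simpa using hr, fun w hw _ => by simp [hw]⟩

variable (Γ c l) in
/-- The operator on the free module over the states that applies a letter where this is possible,
and is zero on the other states. -/
noncomputable def letterOp (R : Type*) [CommRing R] (v : V) : Module.End R ((V → ℕ) →₀ R) :=
  Finsupp.linearCombination R fun n =>
    if Addable Γ c l v n then Finsupp.single (n + Pi.single v 1) 1 else 0

variable {R : Type*} [CommRing R]

theorem letterOp_single (v : V) (n : V → ℕ) : letterOp Γ c l R v (Finsupp.single n 1) =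
    if Addable Γ c l v n then Finsupp.single (n + Pi.single v 1) 1 else 0 := by
  simp [letterOp]

theorem commute_letterOp (v w : V) (h : Γ.Adj v w) :
    Commute (letterOp Γ c l R v) (letterOp Γ c l R w) := by
  have hvw := h.ne
  have h1 (n : V → ℕ) : Addable Γ c l v (n + Pi.single w 1) ↔ Addable Γ c l v n :=
    addable_congr (by simp [hvw]) fun u _ hu' => by
      have : u ≠ w := by rintro rfl; exact hu' h
      simp [this]
  have h2 (n : V → ℕ) : Addable Γ c l w (n + Pi.single v 1) ↔ Addable Γ c l w n :=
    addable_congr (by simp [hvw.symm]) fun u _ hu' => by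
      have : u ≠ v := by rintro rfl; exact hu' h.symm
      simp [this]
  refine Finsupp.lhom_ext' fun n => LinearMap.ext_ring ?_
  simp only [LinearMap.comp_apply, Finsupp.lsingle_apply, Module.End.mul_apply, letterOp_single]
  by_cases hv : Addable Γ c l v n <;> by_cases hw : Addable Γ c l w n <;>
    simp [hv, hw, letterOp_single, h1, h2, add_right_comm]

theorem letterOp_pow_single (v : V) (n : V → ℕ) (b : ℕ) :
    (letterOp Γ c l R v ^ b) (Finsupp.single n 1) =
      if ∀ r < b, Addable Γ c l v (n + r • Pi.single v 1) then
        Finsupp.single (n + b • Pi.single v 1) 1 else 0 := by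
  induction b with
  | zero => simp
  | succ b ih =>
    rw [pow_succ', Module.End.mul_apply, ih]
    by_cases h : ∀ r < b, Addable Γ c l v (n + r • Pi.single v 1)
    · rw [if_pos h, letterOp_single]
      have : (∀ r < b + 1, Addable Γ c l v (n + r • Pi.single v 1)) ↔
          Addable Γ c l v (n + b • Pi.single v 1) :=
        ⟨fun h' => h' b b.lt_succ_self, fun h' r hr =>
          (Nat.lt_succ_iff_lt_or_eq.mp hr).elim (h r) fun e => e ▸ h'⟩
      simp only [this, succ_nsmul, add_assoc]
    · rw [if_neg h, map_zero, if_neg fun h' => h fun r hr => h' r (by omega)]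

theorem letterOp_pow_apply (hl : IsReduced Γ l) (hc : ∀ e ≠ 0, 0 < c e) {v : V} {e : ℤ}
    {s : List (V × ℤ)} (hs : (v, e) :: s <:+ l) (b : ℕ) {x : (V → ℕ) →₀ R}
    (hx : x ∈ Finsupp.supported R R {n | n ≤ letterCount c s}) :
    (letterOp Γ c l R v ^ b) x ∈ Finsupp.supported R R {n | n ≤ letterCount c ((v, e) :: s)} ∧
      (letterOp Γ c l R v ^ b) x (letterCount c ((v, e) :: s)) =
        if b = c e then x (letterCount c s) else 0 := by
  rw [Finsupp.supported_eq_span_single] at hx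
  induction hx using Submodule.span_induction with
  | zero => simp
  | add x y _ _ h h' =>
    rw [map_add]
    refine ⟨add_mem h.1 h'.1, ?_⟩
    rw [Finsupp.add_apply, h.2, h'.2]
    split_ifs <;> simp
  | smul r x _ h =>
    rw [map_smul]
    refine ⟨Submodule.smul_mem _ _ h.1, ?_⟩
    rw [Finsupp.smul_apply, h.2]
    split_ifs <;> simp
  | mem x hx =>
    obtain ⟨n, hn, rfl⟩ := hx
    rw [letterOp_pow_single]
    by_cases h : ∀ r < b, Addable Γ c l v (n + r • Pi.single v 1)
    · rw [if_pos h]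
      refine ⟨Finsupp.single_mem_supported _ _
        (add_nsmul_single_le_letterCount hl hc hs hn h), ?_⟩
      by_cases hb : n + b • Pi.single v 1 = letterCount c ((v, e) :: s)
      · obtain ⟨h1, h2⟩ := eq_of_add_nsmul_single_eq_letterCount hl hc hs hn h hb
        rw [hb, if_pos h1, h2]
        simp
      · rw [Finsupp.single_eq_of_ne' hb]
        split_ifs with h1
        · rw [Finsupp.single_eq_of_ne']
          rintro rfl
          apply hb
          ext w
          by_cases hw : w = v
          · subst hw; simp [letterCount_cons_self, h1]
          · simp [letterCount_cons_of_ne hw, hw]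
        · rfl
    · rw [if_neg h]
      refine ⟨zero_mem _, ?_⟩
      split_ifs with h1
      · rw [Finsupp.single_eq_of_ne']
        · rfl
        · rintro rfl
          exact h fun r hr => addable_letterCount_add hs (h1 ▸ hr)
      · rfl

open PowerSeries

variable (Γ c l R) in
/-- The coefficients of the Magnus representation attached to the letter operators. -/
noncomputable def letterCoeff (n : ℕ) (g : RAAG Γ) : Module.End R ((V → ℕ) →₀ R) :=
  magnusCoeff (R := R) (A := Module.End R ((V → ℕ) →₀ R)) (a := letterOp Γ c l R)
    commute_letterOp n g

/-- The coefficient of the Magnus representation at the letter count of a reduced word does not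
vanish. -/
theorem coeff_magnus_wordProd [IsDomain R] (hl : IsReduced Γ l) (hc : ∀ e ≠ 0, 0 < c e)
    (hce : ∀ e ≠ 0, coeff (c e) ((unitOneAddX R ^ e : (PowerSeries R)ˣ) : PowerSeries R) ≠ 0)
    {s : List (V × ℤ)} (hs : s <:+ l) :
    (∀ d, letterCoeff Γ c l R d
      (wordProd Γ s) (Finsupp.single 0 1) ∈
        Finsupp.supported R R {n | n ≤ letterCount c s}) ∧
    letterCoeff Γ c l R
      (s.map fun x => c x.2).sum (wordProd Γ s) (Finsupp.single 0 1) (letterCount c s) ≠ 0 := by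
  induction s with
  | nil =>
    refine ⟨fun d => ?_, ?_⟩
    · rw [wordProd_nil, letterCoeff, magnusCoeff_one]
      split_ifs
      · exact Finsupp.single_mem_supported _ _ (Pi.le_def.mpr fun _ => Nat.zero_le _)
      · exact zero_mem _
    · have : letterCount c ([] : List (V × ℤ)) = 0 := by ext; simp [letterCount]
      simp [this, letterCoeff, magnusCoeff_one]
  | cons x s ih =>
    obtain ⟨v, e⟩ := x
    obtain ⟨ih1, ih2⟩ := ih ((List.suffix_cons _ _).trans hs)
    have hmul (d : ℕ) : letterCoeff Γ c l R d
        (wordProd Γ ((v, e) :: s)) (Finsupp.single 0 1) =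
        ∑ ij ∈ Finset.HasAntidiagonal.antidiagonal d,
          coeff ij.1 ((unitOneAddX R ^ e : (PowerSeries R)ˣ) : PowerSeries R) •
            (letterOp Γ c l R v ^ ij.1)
              (letterCoeff Γ c l R ij.2
                (wordProd Γ s) (Finsupp.single 0 1)) := by
      rw [wordProd_cons, letterCoeff, magnusCoeff_mul, LinearMap.sum_apply]
      refine Finset.sum_congr rfl fun ij _ => ?_
      rw [magnusCoeff_of_zpow, Module.End.mul_apply, LinearMap.smul_apply]
      rfl
    refine ⟨fun d => ?_, ?_⟩
    · rw [hmul]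
      exact sum_mem fun ij _ => Submodule.smul_mem _ _ (letterOp_pow_apply hl hc hs _ (ih1 _)).1
    · rw [hmul, Finsupp.finsetSum_apply, Finset.sum_eq_single_of_mem
        (c e, (s.map fun x => c x.2).sum) (by simp)]
      · rw [Finsupp.smul_apply, (letterOp_pow_apply hl hc hs _ (ih1 _)).2, if_pos rfl]
        exact mul_ne_zero (hce e (hl.exponent_ne_zero (v, e) (hs.mem (by simp)))) ih2
      · intro ij hij hne
        rw [Finsupp.smul_apply, (letterOp_pow_apply hl hc hs _ (ih1 _)).2, if_neg, smul_zero]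
        intro h
        refine hne (Prod.ext h ?_)
        have := Finset.HasAntidiagonal.mem_antidiagonal.mp hij
        simp only [List.map_cons, List.sum_cons] at this
        simp only
        omega

end

theorem unitOneAddX_zpow_ne_one {R : Type*} [CommRing R] [Nontrivial R] {e : ℤ} (he : e ≠ 0) :
    PowerSeries.unitOneAddX R ^ e ≠ 1 := by
  have key (n : ℕ) (hn : n ≠ 0) : PowerSeries.unitOneAddX R ^ n ≠ 1 := by
    intro h
    have h1 := congrArg (fun u : (PowerSeries R)ˣ => PowerSeries.coeff n (u : PowerSeries R)) h
    have h2 : (1 + PowerSeries.X : PowerSeries R) ^ n =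
        ((1 + Polynomial.X : Polynomial R) ^ n : Polynomial R) := by simp
    simp only [Units.val_pow_eq_pow_val, PowerSeries.val_unitOneAddX, h2, Polynomial.coeff_coe,
      Polynomial.coeff_one_add_X_pow, Nat.choose_self, Nat.cast_one, Units.val_one,
      PowerSeries.coeff_one, if_neg hn] at h1
    exact one_ne_zero h1
  intro h
  refine key e.natAbs (by simpa using he) ?_
  rcases Int.natAbs_eq e with h' | h'
  · rw [h', zpow_natCast] at h
    exact h
  · rw [h', zpow_neg, inv_eq_one, zpow_natCast] at h
    exact h

theorem exists_coeff_unitOneAddX_zpow_ne_zero (R : Type*) [CommRing R] [Nontrivial R] {e : ℤ}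
    (he : e ≠ 0) : ∃ n, 0 < n ∧ PowerSeries.coeff n
      ((PowerSeries.unitOneAddX R ^ e : (PowerSeries R)ˣ) : PowerSeries R) ≠ 0 := by
  by_contra! h
  refine unitOneAddX_zpow_ne_one (R := R) he (Units.ext (PowerSeries.ext fun n => ?_))
  rcases n.eq_zero_or_pos with rfl | hn
  · have hu : PowerSeries.unitOneAddX R ∈ PowerSeries.congruenceUnits R 1 := fun i hi => by
      obtain rfl : i = 0 := by omega
      simp
    rw [PowerSeries.coeff_zero_of_mem_congruenceUnits one_pos (zpow_mem hu e)]
    simp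
  · rw [h n hn, Units.val_one, PowerSeries.coeff_one, if_neg hn.ne']

theorem eq_one_of_forall_mem_pGammaSeries (p : ℕ) [Fact p.Prime] {g : RAAG Γ}
    (hg : ∀ n ≥ 1, g ∈ pGammaSeries p (RAAG Γ) n) : g = 1 := by
  obtain ⟨l, hl, rfl⟩ := exists_isReduced_wordProd_eq g
  choose! c hc hce using fun e (he : e ≠ 0) => exists_coeff_unitOneAddX_zpow_ne_zero (ZMod p) he
  rcases l with _ | ⟨x, l⟩
  · rfl
  exfalso
  refine (coeff_magnus_wordProd (R := ZMod p) hl hc hce List.suffix_rfl).2 ?_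
  have hpos : 0 < ((x :: l).map fun x => c x.2).sum := by
    have := hc x.2 (hl.exponent_ne_zero x (by simp))
    simp only [List.map_cons, List.sum_cons]
    omega
  have hp : ((p : ℕ) : Module.End (ZMod p) ((V → ℕ) →₀ ZMod p)) = 0 := by
    rw [← map_natCast (algebraMap (ZMod p) (Module.End (ZMod p) ((V → ℕ) →₀ ZMod p))),
      CharP.cast_eq_zero, map_zero]
  have h := magnus_mem_congruenceUnits_of_mem_pGammaSeries (R := ZMod p)
    (commute_letterOp (Γ := Γ) (c := c) (l := x :: l)) p hp _
    (hg (((x :: l).map fun x => c x.2).sum + 1) (by omega))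
  rw [letterCoeff, magnusCoeff, PowerSeries.coeff_eq_zero_of_mem_congruenceUnits_succ hpos h]
  rfl

end Detect

end RAAG

/-! ### The `p`-dimension series -/

section PGammaSeries

variable {G : Type*} [Group G] (p : ℕ) [Fact p.Prime]

instance powerSubgroup_normal (H : Subgroup G) [hH : H.Normal] (m : ℕ) :
    (powerSubgroup H m).Normal where
  conj_mem x hx g := by
    induction hx using Subgroup.closure_induction with
    | mem x hx =>
      obtain ⟨h, hh, rfl⟩ := hx
      exact Subgroup.subset_closure ⟨g * h * g⁻¹, hH.conj_mem h hh g, conj_pow.symm⟩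
    | one => simp
    | mul x y _ _ h h' => rw [← conj_mul]; exact mul_mem h h'
    | inv x _ h => rw [← conj_inv]; exact inv_mem h

theorem powerSubgroup_mono {H K : Subgroup G} (h : H ≤ K) (m : ℕ) :
    powerSubgroup H m ≤ powerSubgroup K m :=
  Subgroup.closure_mono fun _ ⟨x, hx, e⟩ => ⟨x, h hx, e⟩

theorem pGammaSeries_add_two (n : ℕ) : pGammaSeries p G (n + 2) =
    ⁅pGammaSeries p G (n + 1), ⊤⁆ ⊔ powerSubgroup (pGammaSeries p G ((n + 2) ⌈/⌉ p)) p := by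
  rw [pGammaSeries]

instance pGammaSeries_normal (n : ℕ) : (pGammaSeries p G n).Normal := by
  induction n using Nat.strong_induction_on with
  | _ n ih =>
    match n with
    | 0 => rw [pGammaSeries]; infer_instance
    | 1 => rw [pGammaSeries]; infer_instance
    | n + 2 =>
      have := ih (n + 1) (by omega)
      have := ih _ (ceilDiv_prime_lt p n)
      rw [pGammaSeries_add_two]
      infer_instance

theorem pGammaSeries_antitone : Antitone (pGammaSeries p G) := by
  suffices ∀ n, ∀ m ≤ n, pGammaSeries p G n ≤ pGammaSeries p G m from fun m n h => this n m h
  intro n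
  induction n using Nat.strong_induction_on with
  | _ n ih =>
    match n with
    | 0 => exact fun m hm => by rw [Nat.le_zero.mp hm]
    | 1 => exact fun m hm => by interval_cases m <;> simp [pGammaSeries]
    | 2 =>
      intro m hm
      interval_cases m <;> simp [pGammaSeries]
    | n + 3 =>
      have h : pGammaSeries p G (n + 3) ≤ pGammaSeries p G (n + 2) := by
        rw [pGammaSeries_add_two p (n + 1), sup_le_iff]
        refine ⟨Subgroup.commutator_le_left _ _, ?_⟩
        rw [pGammaSeries_add_two p n]
        refine le_trans (powerSubgroup_mono (ih _ (ceilDiv_prime_lt p (n + 1)) _ ?_) p) le_sup_right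
        simp only [Nat.ceilDiv_eq_add_pred_div]
        exact Nat.div_le_div_right (by omega)
      intro m hm
      rcases hm.eq_or_lt with rfl | hm
      · exact le_rfl
      · exact h.trans (ih (n + 2) (by omega) m (by omega))

theorem commutator_pGammaSeries_le (n : ℕ) :
    ⁅pGammaSeries p G (n + 1), ⊤⁆ ≤ pGammaSeries p G (n + 2) := by
  rw [pGammaSeries_add_two]
  exact le_sup_left

theorem pow_mem_pGammaSeries {n : ℕ} {g : G} (hg : g ∈ pGammaSeries p G (n + 1)) :
    g ^ p ∈ pGammaSeries p G (n + 2) := by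
  rw [pGammaSeries_add_two]
  refine Subgroup.mem_sup_right (Subgroup.subset_closure ⟨g, ?_, rfl⟩)
  exact pGammaSeries_antitone p (Nat.lt_succ_iff.mp (ceilDiv_prime_lt p n)) hg

theorem pow_pow_mem_pGammaSeries (n : ℕ) (g : G) : g ^ p ^ n ∈ pGammaSeries p G (n + 1) := by
  induction n with
  | zero => simp [pGammaSeries]
  | succ n ih =>
    rw [pow_succ, pow_mul]
    exact pow_mem_pGammaSeries p ih

theorem gammaSeries_le_pGammaSeries (n : ℕ) : gammaSeries G n ≤ pGammaSeries p G n := by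
  match n with
  | 0 => simp [pGammaSeries]
  | n + 1 =>
  induction n with
  | zero => simp [pGammaSeries]
  | succ n ih =>
    exact (Subgroup.commutator_mono ih le_rfl).trans (commutator_pGammaSeries_le p n)

theorem isPGroup_quotient_pGammaSeries (n : ℕ) : IsPGroup p (G ⧸ pGammaSeries p G (n + 1)) := by
  intro x
  obtain ⟨g, rfl⟩ := QuotientGroup.mk_surjective x
  refine ⟨n, ?_⟩
  rw [← QuotientGroup.mk_pow, QuotientGroup.eq_one_iff]
  exact pow_pow_mem_pGammaSeries p n g

/-- The `p`-dimension series of a finitely generated group has terms of finite index: its successive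
quotients are finitely generated elementary abelian `p`-groups. -/
theorem finiteIndex_pGammaSeries [Group.FG G] (n : ℕ) : (pGammaSeries p G n).FiniteIndex := by
  match n with
  | 0 => rw [pGammaSeries]; infer_instance
  | n + 1 =>
  induction n with
  | zero => rw [pGammaSeries]; infer_instance
  | succ n ih =>
    let P := pGammaSeries p G (n + 1)
    let Q := (pGammaSeries p G (n + 2)).subgroupOf P
    have hle : pGammaSeries p G (n + 2) ≤ P := pGammaSeries_antitone p (Nat.le_succ _)
    let _ : CommGroup (P ⧸ Q) :=
      { (inferInstance : Group (P ⧸ Q)) with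
        mul_comm := fun a b => by
          induction a using QuotientGroup.induction_on with | _ a
          induction b using QuotientGroup.induction_on with | _ b
          refine QuotientGroup.eq.mpr ?_
          rw [Subgroup.mem_subgroupOf]
          have h := commutator_pGammaSeries_le p n
            (Subgroup.commutator_mem_commutator (inv_mem b.2) (Subgroup.mem_top (a : G)⁻¹))
          simpa [commutatorElement_def, mul_assoc] using h }
    have hfin : Finite (P ⧸ Q) := by
      refine CommGroup.finite_of_fg_isMulTorsion _ fun x => ?_
      obtain ⟨g, rfl⟩ := QuotientGroup.mk_surjective x
      refine isOfFinOrder_iff_pow_eq_one.mpr ⟨p, Nat.Prime.pos Fact.out, ?_⟩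
      rw [← QuotientGroup.mk_pow, QuotientGroup.eq_one_iff, Subgroup.mem_subgroupOf]
      exact pow_mem_pGammaSeries p g.2
    have h1 : (pGammaSeries p G (n + 2)).relIndex P ≠ 0 :=
      Subgroup.index_ne_zero_of_finite (H := Q)
    refine ⟨?_⟩
    rw [← Subgroup.relIndex_mul_index hle]
    exact mul_ne_zero h1 ih.index_ne_zero

end PGammaSeries

/-! ### Retractions onto full subgraphs -/

namespace RAAG

variable {V : Type*} {Γ : SimpleGraph V}

open scoped Classical in
/-- The retraction onto the subgroup of a full subgraph, which kills the other vertices. -/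
noncomputable def retract (Γ : SimpleGraph V) (S : Set V) : RAAG Γ →* RAAG (Γ.induce S) :=
  lift (fun v => if h : v ∈ S then PresentedGroup.of ⟨v, h⟩ else 1) fun v w h => by
    split_ifs with hv hw
    · exact commute_of_adj (Γ := Γ.induce S) (v := ⟨v, hv⟩) (w := ⟨w, hw⟩) h
    all_goals simp

/-- The homomorphism induced by the inclusion of a full subgraph. -/
def inclusion (Γ : SimpleGraph V) (S : Set V) : RAAG (Γ.induce S) →* RAAG Γ :=
  lift (fun v => PresentedGroup.of v.1) fun _ _ h => commute_of_adj h

/-- Every element lies in the subgroup of a full subgraph with finitely many vertices. -/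
theorem exists_finite_inclusion_retract (g : RAAG Γ) :
    ∃ S : Set V, S.Finite ∧ inclusion Γ S (retract Γ S g) = g := by
  obtain ⟨l, rfl⟩ := exists_wordProd_eq g
  refine ⟨{v | ∃ x ∈ l, x.1 = v}, ?_, ?_⟩
  · exact (l.map Prod.fst).finite_toSet.subset fun v ⟨x, hx, h⟩ => by
      simpa using ⟨x.2, h ▸ hx⟩
  · suffices ∀ S : Set V, ∀ l : List (V × ℤ), (∀ x ∈ l, x.1 ∈ S) →
        inclusion Γ S (retract Γ S (wordProd Γ l)) = wordProd Γ l from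
      this _ l fun x hx => ⟨x, hx, rfl⟩
    intro S l hl
    induction l with
    | nil => simp
    | cons x l ih =>
      rw [wordProd_cons, map_mul, map_mul, ih fun y hy => hl y (by simp [hy]), map_zpow, map_zpow]
      congr 2
      simp [retract, inclusion, hl x (by simp)]

theorem map_mem_gammaSeries {G H : Type*} [Group G] [Group H] (f : G →* H) {n : ℕ} {g : G}
    (hg : g ∈ gammaSeries G n) : f g ∈ gammaSeries H n :=
  Subgroup.lowerCentralSeries_mono _ le_top
    (Subgroup.map_lowerCentralSeries ⊤ f _ ▸ Subgroup.mem_map_of_mem f hg)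

/-- The terms of the lower central series of a right angled Artin group are isolated. -/
theorem mem_gammaSeries_of_zpow_mem {n : ℕ} {g : RAAG Γ} {k : ℤ} (hk : k ≠ 0)
    (hg : g ^ k ∈ gammaSeries (RAAG Γ) n) : g ∈ gammaSeries (RAAG Γ) n := by
  obtain ⟨S, hS, h⟩ := exists_finite_inclusion_retract g
  have := hS.to_subtype
  rw [← h]
  refine map_mem_gammaSeries _ (mem_gammaSeries_of_zpow_mem_of_finite hk ?_)
  rw [← map_zpow]
  exact map_mem_gammaSeries _ hg

theorem gammaSeries_eq_rationalGammaSeries (n : ℕ) :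
    (gammaSeries (RAAG Γ) n : Set (RAAG Γ)) = rationalGammaSeries (RAAG Γ) n :=
  Set.Subset.antisymm (fun g hg => ⟨1, one_ne_zero, by rwa [zpow_one]⟩)
    fun _ ⟨_, hk, hg⟩ => mem_gammaSeries_of_zpow_mem hk hg

theorem eq_one_of_forall_mem_gammaSeries {g : RAAG Γ}
    (hg : ∀ n ≥ 1, g ∈ gammaSeries (RAAG Γ) n) : g = 1 :=
  have : Fact (Nat.Prime 2) := ⟨Nat.prime_two⟩
  eq_one_of_forall_mem_pGammaSeries 2 fun n hn => gammaSeries_le_pGammaSeries 2 n (hg n hn)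

theorem isResiduallyTorsionFreeNilpotent (Γ : SimpleGraph V) :
    IsResiduallyTorsionFreeNilpotent (RAAG Γ) := by
  intro g hg
  obtain ⟨n, -, hn⟩ : ∃ n ≥ 1, g ∉ gammaSeries (RAAG Γ) n := by
    by_contra! h
    exact hg (eq_one_of_forall_mem_gammaSeries h)
  refine ⟨gammaSeries (RAAG Γ) n, inferInstance, hn, ?_, fun x hx => ?_⟩
  · refine Subgroup.nilpotent_iff_lowerCentralSeries.mpr ⟨n - 1, ?_⟩
    rw [← Subgroup.map_top_of_surjective _ (QuotientGroup.mk'_surjective (gammaSeries (RAAG Γ) n)),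
      ← Subgroup.map_lowerCentralSeries, Subgroup.map_eq_bot_iff, QuotientGroup.ker_mk']
    exact le_rfl
  · obtain ⟨x, rfl⟩ := QuotientGroup.mk_surjective x
    obtain ⟨k, hk, hxk⟩ := isOfFinOrder_iff_pow_eq_one.mp hx
    rw [← QuotientGroup.mk_pow, QuotientGroup.eq_one_iff] at hxk
    rw [QuotientGroup.eq_one_iff]
    exact mem_gammaSeries_of_zpow_mem (k := k) (by exact_mod_cast hk.ne') (by simpa using hxk)

theorem isResiduallyFinitePGroup (Γ : SimpleGraph V) (p : ℕ) [Fact p.Prime] :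
    IsResiduallyFinitePGroup p (RAAG Γ) := by
  intro g hg
  obtain ⟨S, hS, h⟩ := exists_finite_inclusion_retract g
  have := hS.to_subtype
  obtain ⟨n, hn1, hn⟩ : ∃ n ≥ 1, retract Γ S g ∉ pGammaSeries p (RAAG (Γ.induce S)) n := by
    by_contra! h'
    rw [eq_one_of_forall_mem_pGammaSeries p h', map_one] at h
    exact hg h.symm
  obtain ⟨n, rfl⟩ := Nat.exists_eq_add_of_le' hn1
  have := fg (Γ := Γ.induce S)
  have := finiteIndex_pGammaSeries p (G := RAAG (Γ.induce S)) (n + 1)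
  -- The quotient by the preimage of `γ_{n,p}` embeds into the quotient by `γ_{n,p}`.
  let f := (QuotientGroup.mk' (pGammaSeries p (RAAG (Γ.induce S)) (n + 1))).comp (retract Γ S)
  refine ⟨f.ker, inferInstance, ?_, ?_, ?_⟩
  · rwa [MonoidHom.mem_ker, MonoidHom.comp_apply, QuotientGroup.mk'_apply, QuotientGroup.eq_one_iff]
  · exact Finite.of_injective _ (QuotientGroup.kerLift_injective f)
  · exact (isPGroup_quotient_pGammaSeries p n).of_injective _ (QuotientGroup.kerLift_injective f)

end RAAG

theorem theorem1 {V : Type*} (Γ : SimpleGraph V) :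
    (∀ n : ℕ, 1 ≤ n → (gammaSeries (RAAG Γ) n : Set (RAAG Γ)) = rationalGammaSeries (RAAG Γ) n) ∧
    (⋂ n ≥ 1, rationalGammaSeries (RAAG Γ) n) = {1} ∧
    (∀ (p : ℕ) [Fact p.Prime], (⨅ n ≥ 1, pGammaSeries p (RAAG Γ) n) = ⊥) ∧
    (Finite V → Group.FG (RAAG Γ)) ∧
    IsResiduallyTorsionFreeNilpotent (RAAG Γ) ∧
    (∀ p : ℕ, p.Prime → IsResiduallyFinitePGroup p (RAAG Γ)) := by
  refine ⟨fun n _ => RAAG.gammaSeries_eq_rationalGammaSeries n, ?_, fun p _ => ?_,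
    fun _ => RAAG.fg, RAAG.isResiduallyTorsionFreeNilpotent Γ, fun p hp => ?_⟩
  · simp only [← RAAG.gammaSeries_eq_rationalGammaSeries]
    refine Set.Subset.antisymm (fun g hg => RAAG.eq_one_of_forall_mem_gammaSeries ?_) ?_
    · simpa using hg
    · rintro _ rfl
      simp [one_mem]
  · rw [eq_bot_iff]
    intro g hg
    simp only [Subgroup.mem_iInf] at hg
    exact RAAG.eq_one_of_forall_mem_pGammaSeries p hg
  · have := Fact.mk hp
    exact RAAG.isResiduallyFinitePGroup Γ p
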